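/- Let $N>1$. For $i\in\mathcal V=\{1,\dots,N\}$, player $i$ has order $m_i>1$, state $x_i=(x_{i1},\dots,x_{im_i})^T\in\mathbb R^{m_i}$, input $u_i\in\mathbb R$ and action $y_i\in\mathbb R$ with $$\dot x_i=A_ix_i+B_iu_i,\qquad y_i=x_{i1},$$ where $A_i$ has ones on the superdiagonal and zeros elsewhere and $B_i=(0,\dots,0,1)^T$. Let $f_i:\mathbb R^N\to\mathbb R$ be continuously differentiable and write $\nabla_if_i=\partial f_i/\partial y_i$ and $\|\cdot\|$ for the Euclidean norm. Assume: (1) for each $i$ there is $l_i>0$ with $|\nabla_if_i(\mathbf y)-\nabla_if_i(\mathbf z)|\le l_i\|\mathbf y-\mathbf z\|$ for all $\mathbf y,\mathbf z\in\mathbb R^N$; (2) there is $\omega>0$ with $\sum_{i}(y_i-z_i)(\nabla_if_i(\mathbf y)-\nabla_if_i(\mathbf z))\ge\omega\|\mathbf y-\mathbf z\|^2$ for all $\mathbf y,\mathbf z\in\mathbb R^N$; (3) $[a_{ij}]$ is a real $N\times N$ matrix with $a_{ij}\ge 0$ and $a_{ii}=0$, and the directed graph on $\mathcal V$ with an edge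 from $i$ to $j$ exactly when $a_{ji}>0$ is strongly connected. Fix $\theta_i\in(0,\tfrac12)$ and $\Delta_i>0$, and let $\phi_i(\varsigma)=\mathrm{sign}(\varsigma)\min\{|\varsigma|,\Delta_i\}$. Let $\bar A_i\in\mathbb R^{m_i\times m_i}$ be the strictly upper triangular matrix with $(p,q)$ entry $\theta_i^{m_i-q+1}$ for $p<q$ and $0$ otherwise, let $\bar B_i=(1,\dots,1)^T$, and let $T_i=\mathbf R(A_i,B_i)\mathbf R(\bar A_i,\bar B_i)^{-1}$, where $\mathbf R(A,B)=[B,AB,\dots,A^{m_i-1}B]$. Put $\bar x_i=T_i^{-1}x_i$. Let $z_{ij},c_{ij}$ ($i,j\in\mathcal V$) be real auxiliary variables, $\mathbf z_i=(z_{i1},\dots,z_{iN})^T$, and $w_i(t)=\int_0^t\nabla_if_i(\mathbf z_i(\tau))\,d\tau$. Consider the closed-loop system $$u_i=-\sum_{k=1}^{m_i-1}\theta_i^k\phi_i(\bar x_{i(m_i-k+1)})-\theta_i^{m_i}\phi_i\Big(\bar x_{i1}+w_i\prod_{k=1}^{m_i-1}\theta_i^k\Big),$$ $$\dot z_{ij}=-(c_{ij}+\rho_{ij})\xi_{ij},\qquad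 \dot c_{ij}=\rho_{ij},\qquad c_{ij}(0)>0,$$ $$\xi_{ij}=\sum_{k=1}^Na_{ik}(z_{ij}-z_{kj})+a_{ij}(z_{ij}+w_j),\qquad \rho_{ij}=\xi_{ij}^2.$$ Then there is exactly one Nash equilibrium $\mathbf y^*$, i.e. exactly one $\mathbf y^*\in\mathbb R^N$ with $f_i(y_i^*,\mathbf y_{-i}^*)\le f_i(s,\mathbf y_{-i}^*)$ for all $i\in\mathcal V$ and $s\in\mathbb R$. For all initial values $x_i(0)\in\mathbb R^{m_i}$, $z_{ij}(0)\in\mathbb R$ and $c_{ij}(0)>0$, the closed-loop system has a solution on $[0,\infty)$, and every solution on $[0,\infty)$ satisfies $$\lim_{t\to\infty}\|\mathbf y(t)-\mathbf y^*\|=0;$$ moreover all components of $x_i(t)$, and $z_{ij}(t)$ and $c_{ij}(t)$, for all $i,j\in\mathcal V$, stay bounded on $[0,\infty)$ and converge to finite values as $t\to\infty$. -/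

import Mathlib

open scoped Matrix

namespace NashSeeking

noncomputable section

/-- Euclidean norm of a real vector indexed by the players. -/
def euclNorm {N : ℕ} (v : Fin N → ℝ) : ℝ := ‖WithLp.toLp 2 v‖

/-- Partial derivative of `f i` with respect to the player's own action `y i`, at `y`. -/
def ownGrad {N : ℕ} (f : Fin N → (Fin N → ℝ) → ℝ) (i : Fin N) (y : Fin N → ℝ) : ℝ :=
  fderiv ℝ (f i) y (Pi.single i 1)

/-- Nash equilibrium: no player can lower its objective by changing its own action only. -/
def IsNash {N : ℕ} (f : Fin N → (Fin N → ℝ) → ℝ) (y : Fin N → ℝ) : Prop :=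
  ∀ (i : Fin N) (s : ℝ), f i y ≤ f i (Function.update y i s)

/-- The objectives are `C¹` and each own partial gradient is globally Lipschitz. -/
def SmoothLipschitz {N : ℕ} (f : Fin N → (Fin N → ℝ) → ℝ) : Prop :=
  (∀ i, ContDiff ℝ 1 (f i)) ∧
    ∀ i, ∃ l : ℝ, 0 < l ∧
      ∀ y z : Fin N → ℝ, |ownGrad f i y - ownGrad f i z| ≤ l * euclNorm (y - z)

/-- The pseudo-gradient `y ↦ (∇ᵢ fᵢ(y))ᵢ` is strongly monotone. -/
def StronglyMonotone {N : ℕ} (f : Fin N → (Fin N → ℝ) → ℝ) : Prop :=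
  ∃ ω : ℝ, 0 < ω ∧ ∀ y z : Fin N → ℝ,
    ω * euclNorm (y - z) ^ 2 ≤ ∑ i, (y i - z i) * (ownGrad f i y - ownGrad f i z)

/-- `a` is the weighted adjacency matrix of a directed graph without self-loops; there is an edge
from `i` to `j` exactly when `0 < a j i`. -/
def IsAdjacency {N : ℕ} (a : Matrix (Fin N) (Fin N) ℝ) : Prop :=
  (∀ i j, 0 ≤ a i j) ∧ ∀ i, a i i = 0

/-- Every ordered pair of distinct nodes is joined by a directed path. -/
def StronglyConnected {N : ℕ} (a : Matrix (Fin N) (Fin N) ℝ) : Prop :=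
  ∀ i j : Fin N, i ≠ j → Relation.TransGen (fun p q : Fin N => 0 < a q p) i j

/-- Integrator chain: ones on the superdiagonal. -/
def sysA (m : ℕ) : Matrix (Fin m) (Fin m) ℝ :=
  Matrix.of fun p q => if p.val + 1 = q.val then 1 else 0

/-- Input vector `(0, …, 0, 1)ᵀ`. -/
def sysB (m : ℕ) : Fin m → ℝ := fun p => if p.val + 1 = m then 1 else 0

/-- Output row `(1, 0, …, 0)`. -/
def sysC (m : ℕ) : Fin m → ℝ := fun p => if p.val = 0 then 1 else 0

/-- Strictly upper triangular; in 1-based numbering, column `j` carries `θ ^ (m - j + 1)` above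
the diagonal. -/
def barA (m : ℕ) (θ : ℝ) : Matrix (Fin m) (Fin m) ℝ :=
  Matrix.of fun p q => if p.val < q.val then θ ^ (m - q.val) else 0

/-- Input vector `(1, …, 1)ᵀ`. -/
def barB (m : ℕ) : Fin m → ℝ := fun _ => 1

/-- Controllability matrix `[B, A B, …, A ^ (m - 1) B]`. -/
def ctrb {m : ℕ} (A : Matrix (Fin m) (Fin m) ℝ) (B : Fin m → ℝ) : Matrix (Fin m) (Fin m) ℝ :=
  Matrix.of fun p k => ((A ^ k.val) *ᵥ B) p

/-- The change of coordinates `T`, with `x = T x̄`. -/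
def transf (m : ℕ) (θ : ℝ) : Matrix (Fin m) (Fin m) ℝ :=
  ctrb (sysA m) (sysB m) * (ctrb (barA m θ) (barB m))⁻¹

/-- Transformed state `x̄ = T⁻¹ x`. -/
def barState (m : ℕ) (θ : ℝ) (x : Fin m → ℝ) : Fin m → ℝ := (transf m θ)⁻¹ *ᵥ x

/-- Saturation function at level `Δ`. -/
def sat (Δ s : ℝ) : ℝ := Real.sign s * min |s| Δ

/-- `∫₀ᵗ ∇ᵢ fᵢ(zᵢ(τ)) dτ`, where `z τ i` is the vector `(z i 1, …, z i N)` at time `τ`. -/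
def gradInt {N : ℕ} (f : Fin N → (Fin N → ℝ) → ℝ) (z : ℝ → Fin N → Fin N → ℝ)
    (i : Fin N) (t : ℝ) : ℝ :=
  ∫ τ in (0 : ℝ)..t, ownGrad f i (z τ i)

/-- The bounded control of one player, given its state `x` and the value `w` of its gradient
integral. The index `k : Fin (m - 1)` stands for the summation index `k + 1`, and the coordinate
numbered `m - (k + 1) + 1` from one is numbered `m - (k + 1)` from zero. -/
def control (m : ℕ) (θ Δ : ℝ) (x : Fin m → ℝ) (w : ℝ) : ℝ :=
  -(∑ k : Fin (m - 1),
      θ ^ (k.val + 1) * sat Δ (barState m θ x ⟨m - (k.val + 1), by omega⟩))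
    - θ ^ m * sat Δ (sysC m ⬝ᵥ barState m θ x + (∏ k ∈ Finset.Icc 1 (m - 1), θ ^ k) * w)

/-- Local consensus error `ξ i j`; `w j` is the gradient integral of player `j`. -/
def consErr {N : ℕ} (a : Matrix (Fin N) (Fin N) ℝ) (z : Fin N → Fin N → ℝ) (w : Fin N → ℝ)
    (i j : Fin N) : ℝ :=
  ∑ k, a i k * (z i j - z k j) + a i j * (z i j + w j)

/-- `(x, z, c)` is a (forward complete) trajectory of the closed-loop system on `[0, ∞)`, with
`c i j (0) > 0`. The derivative at time `0` is one-sided. -/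
structure IsTrajectory {N : ℕ} (f : Fin N → (Fin N → ℝ) → ℝ) (a : Matrix (Fin N) (Fin N) ℝ)
    (m : Fin N → ℕ) (θ Δ : Fin N → ℝ)
    (x : ℝ → (i : Fin N) → Fin (m i) → ℝ) (z c : ℝ → Fin N → Fin N → ℝ) : Prop where
  gain_pos : ∀ i j, 0 < c 0 i j
  x_deriv : ∀ i, ∀ t : ℝ, 0 ≤ t →
    HasDerivWithinAt (fun s => x s i)
      (sysA (m i) *ᵥ x t i + control (m i) (θ i) (Δ i) (x t i) (gradInt f z i t) • sysB (m i))
      (Set.Ici 0) t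
  z_deriv : ∀ i j, ∀ t : ℝ, 0 ≤ t →
    HasDerivWithinAt (fun s => z s i j)
      (-(c t i j + consErr a (z t) (fun k => gradInt f z k t) i j ^ 2) *
        consErr a (z t) (fun k => gradInt f z k t) i j)
      (Set.Ici 0) t
  c_deriv : ∀ i j, ∀ t : ℝ, 0 ≤ t →
    HasDerivWithinAt (fun s => c s i j)
      (consErr a (z t) (fun k => gradInt f z k t) i j ^ 2)
      (Set.Ici 0) t

/-- The output (action) profile `y i = C i x i`. -/
def output {N : ℕ} {m : Fin N → ℕ} (x : (i : Fin N) → Fin (m i) → ℝ) : Fin N → ℝ :=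
  fun i => sysC (m i) ⬝ᵥ x i

/-- A real signal is bounded on `[0, ∞)` and converges to a finite value at infinity. -/
def BoundedConvergent (g : ℝ → ℝ) : Prop :=
  (∃ M : ℝ, ∀ t : ℝ, 0 ≤ t → |g t| ≤ M) ∧ ∃ L : ℝ, Filter.Tendsto g Filter.atTop (nhds L)

end

end NashSeeking

/-!
The closed loop is a cascade: an autonomous estimation subsystem in the variables `z`, `c` and
`w` (the gradient integrals), and, for every player, an integrator chain driven by its own `w`.

*Estimation.* The vector `-w` performs a gradient play, `w j` having derivative `∇ⱼ fⱼ` at row `j`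
of `z`, while column `j` of `z` tracks `-w j` by adaptive consensus. The consensus operator
`consOp` is not symmetric, but weighted by a positive left null vector of the graph Laplacian
(`exists_pos_left_null`) it is positive definite (`exists_consOp_coercive`), so that the gains `c`
need no knowledge of the graph. With these weights
`V = ∑ rᵢ (c ξ² + ξ⁴ / 2 + (c - b)² / 2) + (K / 2) ‖w + y*‖²` satisfies
`V' ≤ -(‖w + y*‖² + ∑ ξ²)` once `K` and then `b` are large (`exists_lyapDeriv_le`); strong
monotonicity supplies the negative term in `w + y*`. Sublevel sets of `V` are bounded where
`c ≥ 0` (`exists_bound_of_lyap_le`), and `c` never decreases. Barbalat's lemma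
(`tendsto_zero_of_lyapunov`) then gives `w → -y*`, `ξ → 0`, hence `z → y*`, and the monotone
bounded gains converge.

*Players.* In the coordinates `x̄` the control is a nested saturation with gains `θ ^ (m - q)`.
As `θ < 1 / 2`, each gain exceeds the sum of the smaller ones, so the coordinates leave saturation
one after the other, and what remains is a stable triangular linear system driven by the vanishing
gradient (`saturated_chain_tendsto`). Its limit is a multiple of the first unit vector, and the
first column of `T` is such that `x → (y*ᵢ, 0, …, 0)` (`player_tendsto`).

*Existence.* The field is locally Lipschitz. Multiplying it by a cut-off only rescales time, so the
Lyapunov function still bounds the estimation subsystem and Grönwall's inequality the chains; the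
truncated, bounded field has a solution on every `[0, T]`, which stays where the cut-off is `1`
(`exists_solution_Icc`), and uniqueness glues these solutions (`exists_solution_Ici`).

*Equilibrium.* Strong monotonicity makes Nash equilibria the zeros of the pseudo-gradient
(`isNash_iff`), and a gradient step with small step size is a contraction.
-/

namespace NashSeeking
open Set Filter Topology Metric
open scoped NNReal

/-! ### Asymptotics and global existence for differential equations -/

theorem boundedConvergent_of_tendsto {g : ℝ → ℝ} {L : ℝ} (hc : ContinuousOn g (Ici 0))
    (hg : Tendsto g atTop (𝓝 L)) : BoundedConvergent g := by
  refine ⟨?_, L, hg⟩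
  have h1 : ∀ᶠ t in atTop, |g t| < |L| + 1 :=
    hg.abs.eventually (gt_mem_nhds (by linarith))
  obtain ⟨T, hT⟩ := eventually_atTop.1 h1
  obtain ⟨C, hC⟩ := isCompact_Icc.exists_bound_of_continuousOn (s := Icc (0 : ℝ) T)
    (hc.mono Icc_subset_Ici_self)
  refine ⟨max C (|L| + 1), fun t ht => ?_⟩
  rcases le_total t T with h | h
  · exact (hC t ⟨ht, h⟩).trans (le_max_left _ _)
  · exact (hT t h).le.trans (le_max_right _ _)

/-- A scalar signal that decreases at a definite rate wherever it is at least `r` ends up below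
`r`. -/
theorem eventually_le_of_deriv_le {y y' : ℝ → ℝ} {r ε T₀ : ℝ} (hε : 0 < ε)
    (hy : ∀ t, T₀ ≤ t → HasDerivWithinAt y (y' t) (Ici t) t)
    (hcont : ContinuousOn y (Ici T₀))
    (hdec : ∀ t, T₀ ≤ t → r ≤ y t → y' t ≤ -ε) : ∀ᶠ t in atTop, y t ≤ r := by
  by_cases h : ∃ t₀, T₀ ≤ t₀ ∧ y t₀ ≤ r
  · obtain ⟨t₀, ht₀, hr⟩ := h
    filter_upwards [eventually_ge_atTop t₀] with t ht
    refine image_le_of_deriv_right_lt_deriv_boundary' (a := t₀) (b := t) (f := y) (f' := y')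
      (B := fun _ => r) (B' := fun _ => 0)
      (hcont.mono fun s hs => ht₀.trans hs.1) (fun s hs => hy s (ht₀.trans hs.1)) hr
      continuousOn_const (fun s _ => hasDerivWithinAt_const _ _ _) (fun s hs hsr => ?_)
      (right_mem_Icc.2 ht)
    linarith [hdec s (ht₀.trans hs.1) hsr.ge]
  · push Not at h
    -- otherwise `y` would decrease linearly without bound, yet stay above `r`
    exfalso
    have hT : T₀ ≤ T₀ + (y T₀ - r) / ε := by
      have := h T₀ le_rfl
      have : 0 ≤ (y T₀ - r) / ε := div_nonneg (by linarith) hε.le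
      linarith
    have := image_le_of_deriv_right_le_deriv_boundary (a := T₀) (b := T₀ + (y T₀ - r) / ε)
      (f := y) (f' := y') (B := fun t => y T₀ - ε * (t - T₀)) (B' := fun _ => -ε)
      (hcont.mono Icc_subset_Ici_self) (fun s hs => hy s hs.1) (by simp) (by fun_prop)
      (fun s _ => by
        simpa using ((((hasDerivWithinAt_id s (Ici s)).sub_const T₀).const_mul ε).const_sub (y T₀)))
      (fun s hs => hdec s hs.1 (h s hs.1).le) (right_mem_Icc.2 hT)
    have h2 := h _ hT
    have h3 : ε * (T₀ + (y T₀ - r) / ε - T₀) = y T₀ - r := by field_simp; ring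
    linarith

/-- Two-sided version of `eventually_le_of_deriv_le`. -/
theorem eventually_abs_le_of_deriv {y y' : ℝ → ℝ} {r ε T₀ : ℝ} (hε : 0 < ε)
    (hy : ∀ t, T₀ ≤ t → HasDerivWithinAt y (y' t) (Ici t) t)
    (hcont : ContinuousOn y (Ici T₀))
    (hpos : ∀ t, T₀ ≤ t → r ≤ y t → y' t ≤ -ε)
    (hneg : ∀ t, T₀ ≤ t → y t ≤ -r → ε ≤ y' t) : ∀ᶠ t in atTop, |y t| ≤ r := by
  have h1 := eventually_le_of_deriv_le hε hy hcont hpos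
  have h2 := eventually_le_of_deriv_le (y := fun t => -y t) (y' := fun t => -y' t) (r := r) hε
    (fun t ht => (hy t ht).neg) hcont.neg
    (fun t ht h => by linarith [hneg t ht (by linarith)])
  filter_upwards [h1, h2] with t a b
  exact abs_le.2 ⟨by linarith, a⟩

/-- A stable scalar linear equation driven by a vanishing input tends to zero. -/
theorem tendsto_zero_of_linear_decay {y d : ℝ → ℝ} {b T₀ : ℝ} (hb : 0 < b)
    (hy : ∀ t, T₀ ≤ t → HasDerivWithinAt y (-b * y t + d t) (Ici t) t)
    (hcont : ContinuousOn y (Ici T₀)) (hd : Tendsto d atTop (𝓝 0)) : Tendsto y atTop (𝓝 0) := by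
  rw [Metric.tendsto_nhds]
  intro r hr
  have hd' : ∀ᶠ t in atTop, |d t| < b * (r / 2) / 2 := by
    have h0 : Tendsto (fun t => |d t|) atTop (𝓝 0) := by simpa using hd.abs
    exact h0.eventually (gt_mem_nhds (show 0 < b * (r / 2) / 2 by positivity))
  obtain ⟨T₁, hT₁⟩ := eventually_atTop.1 (hd'.and (eventually_ge_atTop T₀))
  have h := eventually_abs_le_of_deriv (y := y) (y' := fun t => -b * y t + d t) (r := r / 2)
    (ε := b * (r / 2) / 2) (T₀ := T₁) (by positivity) (fun t ht => hy t (hT₁ t ht).2)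
    (hcont.mono fun t ht => (hT₁ t ht).2)
    (fun t ht h => by
      have h1 := (abs_lt.1 (hT₁ t ht).1).2
      have h2 := mul_le_mul_of_nonneg_left h hb.le
      linarith)
    (fun t ht h => by
      have h1 := (abs_lt.1 (hT₁ t ht).1).1
      have h2 := mul_le_mul_of_nonneg_left h hb.le
      linarith)
  filter_upwards [h] with t ht
  simp only [Real.dist_eq, sub_zero]
  linarith

/-- Barbalat's lemma in the form used with a Lyapunov function: along a bounded trajectory of a
continuous autonomous system, if `v` is bounded below and decreases at least at the rate
`h ∘ γ`, with `h` continuous and nonnegative, then `h ∘ γ` tends to zero. -/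
theorem tendsto_zero_of_lyapunov {E : Type*} [NormedAddCommGroup E] [NormedSpace ℝ E]
    [ProperSpace E] {F : E → E} (hF : Continuous F) {γ : ℝ → E}
    (hγ : ∀ t, 0 ≤ t → HasDerivWithinAt γ (F (γ t)) (Ici 0) t) {R : ℝ}
    (hR : ∀ t, 0 ≤ t → ‖γ t‖ ≤ R) {h : E → ℝ} (hh : Continuous h) (hh0 : ∀ x, 0 ≤ h x)
    {v v' : ℝ → ℝ} (hv : ∀ t, 0 ≤ t → HasDerivWithinAt v (v' t) (Ici 0) t)
    (hv' : ∀ t, 0 ≤ t → v' t ≤ -h (γ t)) {b : ℝ} (hb : ∀ t, 0 ≤ t → b ≤ v t) :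
    Tendsto (fun t => h (γ t)) atTop (𝓝 0) := by
  have hmono : AntitoneOn v (Ici 0) := by
    refine antitoneOn_of_hasDerivWithinAt_nonpos (f' := v') (convex_Ici 0)
      (fun t ht => (hv t ht).continuousWithinAt) (fun t ht => ?_) (fun t ht => ?_)
    · exact (hv t (interior_subset ht)).mono interior_subset
    · linarith [hv' t (interior_subset ht), hh0 (γ t)]
  obtain ⟨M, hM⟩ := (isCompact_closedBall (0 : E) R).exists_bound_of_continuousOn hF.continuousOn
  have hM0 : 0 ≤ M := (norm_nonneg _).trans (hM (γ 0) (by simpa using hR 0 le_rfl))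
  have hlip : ∀ s t, 0 ≤ s → 0 ≤ t → ‖γ t - γ s‖ ≤ M * ‖t - s‖ := fun s t hs ht =>
    (convex_Ici (0 : ℝ)).norm_image_sub_le_of_norm_hasDerivWithin_le
      (fun x hx => hγ x hx) (fun x hx => hM _ (by simpa using hR x hx)) hs ht
  have huc : UniformContinuousOn h (closedBall 0 R) :=
    (isCompact_closedBall (0 : E) R).uniformContinuousOn_of_continuous hh.continuousOn
  rw [Metric.tendsto_nhds]
  intro ε hε
  obtain ⟨η, hη, hη'⟩ := Metric.uniformContinuousOn_iff.1 huc (ε / 2) (by positivity)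
  -- on a time step `δ` the value of `h` along the trajectory varies by less than `ε / 2`
  set δ := η / (2 * (M + 1)) with hδdef
  have hδ : 0 < δ := by positivity
  have hMδ : M * δ < η := by
    rw [hδdef, mul_div_assoc', div_lt_iff₀ (by positivity)]
    nlinarith
  have hconv : ∃ l, Tendsto (fun t => v (max t 0)) atTop (𝓝 l) := by
    refine ⟨_, tendsto_atTop_ciInf (fun s t hst => ?_) ⟨b, ?_⟩⟩
    · exact hmono (mem_Ici.2 (le_max_right _ _)) (mem_Ici.2 (le_max_right _ _))
        (max_le_max hst le_rfl)
    · rintro _ ⟨t, rfl⟩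
      exact hb _ (le_max_right _ _)
  obtain ⟨l, hl⟩ := hconv
  have hdiff : Tendsto (fun t => v (max t 0) - v (max (t + δ) 0)) atTop (𝓝 (l - l)) :=
    hl.sub (hl.comp (tendsto_atTop_add_const_right _ δ tendsto_id))
  rw [sub_self] at hdiff
  filter_upwards [hdiff.eventually (gt_mem_nhds (show 0 < δ * (ε / 2) by positivity)),
    eventually_ge_atTop 0] with t ht ht0
  rw [max_eq_left ht0, max_eq_left (by linarith)] at ht
  simp only [Real.dist_eq, sub_zero, abs_of_nonneg (hh0 _)]
  by_contra hcon
  push Not at hcon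
  have key := image_le_of_deriv_right_le_deriv_boundary (a := t) (b := t + δ)
      (f := v) (f' := v') (B := fun s => v t - (ε / 2) * (s - t)) (B' := fun _ => -(ε / 2))
      (fun s hs => ((hv s (ht0.trans hs.1)).continuousWithinAt).mono fun r hr => ht0.trans hr.1)
      (fun s hs => (hv s (ht0.trans hs.1)).mono (Ici_subset_Ici.2 (ht0.trans hs.1)))
      (by simp) (by fun_prop)
      (fun s _ => by
        simpa using
          ((((hasDerivWithinAt_id s (Ici s)).sub_const t).const_mul (ε / 2)).const_sub (v t)))
      (fun s hs => by
        have hs0 := ht0.trans hs.1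
        have h1 : dist (γ s) (γ t) < η := by
          rw [dist_eq_norm]
          refine (hlip t s ht0 hs0).trans_lt (lt_of_le_of_lt ?_ hMδ)
          refine mul_le_mul_of_nonneg_left ?_ hM0
          rw [Real.norm_eq_abs, abs_of_nonneg (by linarith [hs.1])]
          linarith [hs.2]
        have h2 := hη' _ (by simpa using hR s hs0) _ (by simpa using hR t ht0) h1
        rw [Real.dist_eq] at h2
        have h3 := (abs_lt.1 h2).1
        linarith [hv' s hs0])
      (right_mem_Icc.2 (by linarith))
  simp only [add_sub_cancel_left] at key
  linarith

/-- The radial cut-off: `1` on the ball of radius `R`, `0` outside the ball of radius `R + 1`. -/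
noncomputable def cutoff {E : Type*} [NormedAddCommGroup E] (R : ℝ) (x : E) : ℝ :=
  max 0 (min 1 (R + 1 - ‖x‖))

theorem cutoff_mem {E : Type*} [NormedAddCommGroup E] (R : ℝ) (x : E) :
    0 ≤ cutoff R x ∧ cutoff R x ≤ 1 :=
  ⟨le_max_left _ _, max_le zero_le_one (min_le_left _ _)⟩

theorem locallyLipschitz_cutoff {E : Type*} [NormedAddCommGroup E] (R : ℝ) :
    LocallyLipschitz (cutoff R : E → ℝ) := by
  have h : LocallyLipschitz fun x : E => R + 1 - ‖x‖ := by
    have h1 : LipschitzWith 1 fun r : ℝ => R + 1 - r := by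
      refine LipschitzWith.of_dist_le_mul fun a b => ?_
      rw [Real.dist_eq, Real.dist_eq, NNReal.coe_one, one_mul, abs_sub_comm a b]
      exact le_of_eq (by congr 1; ring)
    exact h1.locallyLipschitz.comp lipschitzWith_one_norm.locallyLipschitz
  exact (h.const_min 1).const_max 0

/-- Solutions of a locally Lipschitz autonomous system exist on `[0, T]` if the solutions of all
rescaled systems `γ' = k(t) F(γ)`, `0 ≤ k ≤ 1`, satisfy one a priori bound. Multiplying the field
by a cut-off function produces such a rescaled system. -/
theorem exists_solution_Icc {E : Type*} [NormedAddCommGroup E] [NormedSpace ℝ E]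
    [ProperSpace E] {F : E → E} (hF : LocallyLipschitz F) (x₀ : E) {T R : ℝ} (hT : 0 ≤ T)
    (hR : ∀ (k : ℝ → ℝ) (γ : ℝ → E), (∀ t, 0 ≤ k t ∧ k t ≤ 1) → γ 0 = x₀ →
      (∀ t ∈ Icc 0 T, HasDerivWithinAt γ (k t • F (γ t)) (Icc 0 T) t) →
      ∀ t ∈ Icc 0 T, ‖γ t‖ ≤ R) :
    ∃ γ : ℝ → E, γ 0 = x₀ ∧
      (∀ t ∈ Icc 0 T, HasDerivWithinAt γ (F (γ t)) (Icc 0 T) t) ∧ ∀ t ∈ Icc 0 T, ‖γ t‖ ≤ R := by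
  obtain ⟨M, hM⟩ :=
    (isCompact_closedBall (0 : E) (R + 1)).exists_bound_of_continuousOn hF.continuous.continuousOn
  set G : E → E := fun x => cutoff R x • F x with hG
  have hGM : ∀ x, ‖G x‖ ≤ ((max M 0).toNNReal : ℝ) := by
    intro x
    simp only [hG, norm_smul, Real.norm_eq_abs, abs_of_nonneg (cutoff_mem R x).1,
      Real.coe_toNNReal _ (le_max_right M 0)]
    by_cases hx : ‖x‖ ≤ R + 1
    · calc cutoff R x * ‖F x‖ ≤ 1 * ‖F x‖ :=
            mul_le_mul_of_nonneg_right (cutoff_mem R x).2 (norm_nonneg _)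
        _ ≤ max M 0 := by rw [one_mul]; exact (hM x (by simpa using hx)).trans (le_max_left _ _)
    · have : cutoff R x = 0 := max_eq_left ((min_le_right _ _).trans (by linarith))
      simp [this]
  have hGL : LocallyLipschitz G := by
    have : LocallyLipschitz fun p : ℝ × E => p.1 • p.2 :=
      ContDiff.locallyLipschitz (𝕂 := ℝ) (by fun_prop)
    exact this.comp ((locallyLipschitz_cutoff R).prodMk hF)
  set a : ℝ≥0 := (max M 0 * T).toNNReal with ha
  obtain ⟨K, hK⟩ := hGL.locallyLipschitzOn.exists_lipschitzOnWith_of_compact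
    (isCompact_closedBall x₀ a)
  have hPL : IsPicardLindelof (fun _ => G) (⟨0, left_mem_Icc.2 hT⟩ : Icc 0 T) x₀ a 0
      (max M 0).toNNReal K := by
    refine IsPicardLindelof.of_time_independent (fun x _ => hGM x) hK ?_
    have h0 : 0 ≤ max M 0 := le_max_right _ _
    rw [ha, Real.coe_toNNReal _ h0, Real.coe_toNNReal _ (by positivity)]
    simp [hT]
  obtain ⟨γ, h0, hγ⟩ := hPL.exists_eq_forall_mem_Icc_hasDerivWithinAt₀
  have hb := hR (fun t => cutoff R (γ t)) γ (fun t => cutoff_mem R _) h0 hγ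
  refine ⟨γ, h0, fun t ht => ?_, hb⟩
  have h1 : cutoff R (γ t) = 1 := by
    have := hb t ht
    rw [cutoff, min_eq_left (by linarith), max_eq_right zero_le_one]
  have h2 := hγ t ht
  simp only [hG, h1, one_smul] at h2
  exact h2

/-- Global forward existence for a locally Lipschitz autonomous system with a priori bounds. -/
theorem exists_solution_Ici {E : Type*} [NormedAddCommGroup E] [NormedSpace ℝ E]
    [ProperSpace E] {F : E → E} (hF : LocallyLipschitz F) (x₀ : E)
    (hR : ∀ T : ℝ, 0 ≤ T → ∃ R : ℝ, ∀ (k : ℝ → ℝ) (γ : ℝ → E),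
      (∀ t, 0 ≤ k t ∧ k t ≤ 1) → γ 0 = x₀ →
      (∀ t ∈ Icc 0 T, HasDerivWithinAt γ (k t • F (γ t)) (Icc 0 T) t) →
      ∀ t ∈ Icc 0 T, ‖γ t‖ ≤ R) :
    ∃ γ : ℝ → E, γ 0 = x₀ ∧ ∀ t, 0 ≤ t → HasDerivWithinAt γ (F (γ t)) (Ici 0) t := by
  choose! R hR using hR
  have hex : ∀ n : ℕ, ∃ γ : ℝ → E, γ 0 = x₀ ∧
      (∀ t ∈ Icc (0 : ℝ) n, HasDerivWithinAt γ (F (γ t)) (Icc (0 : ℝ) n) t) ∧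
      ∀ t ∈ Icc (0 : ℝ) n, ‖γ t‖ ≤ R n := fun n =>
    exists_solution_Icc hF x₀ n.cast_nonneg (hR n n.cast_nonneg)
  choose g hg0 hg hgR using hex
  have hright : ∀ (n : ℕ) (T : ℝ), T ≤ n → ∀ t ∈ Ico (0 : ℝ) T,
      HasDerivWithinAt (g n) (F (g n t)) (Ici t) t := by
    intro n T hT t ht
    refine (hg n t ⟨ht.1, ht.2.le.trans hT⟩).mono_of_mem_nhdsWithin ?_
    exact mem_of_superset (Icc_mem_nhdsGE (ht.2.trans_le hT)) (Icc_subset_Icc_left ht.1)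
  have huniq : ∀ n k : ℕ, n ≤ k → EqOn (g n) (g k) (Icc (0 : ℝ) n) := by
    intro n k hnk
    have hnk' : (n : ℝ) ≤ k := by exact_mod_cast hnk
    obtain ⟨K, hK⟩ := hF.locallyLipschitzOn.exists_lipschitzOnWith_of_compact
      (isCompact_closedBall (0 : E) (max (R n) (R k)))
    refine ODE_solution_unique_of_mem_Icc_right (v := fun _ => F)
      (s := fun _ => closedBall (0 : E) (max (R n) (R k))) (fun _ _ => hK)
      (fun t ht => (hg n t ht).continuousWithinAt) (hright n n le_rfl) (fun t ht => ?_)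
      (fun t ht => ?_) (hright k n hnk') (fun t ht => ?_) (by rw [hg0, hg0])
    · simpa using Or.inl (hgR n t ⟨ht.1, ht.2.le⟩)
    · exact (hg k t ⟨ht.1, ht.2.trans hnk'⟩).continuousWithinAt.mono (Icc_subset_Icc_right hnk')
    · simpa using Or.inr (hgR k t ⟨ht.1, ht.2.le.trans hnk'⟩)
  have hglue : ∀ (n : ℕ) (t : ℝ), t ∈ Icc (0 : ℝ) n → g (⌈t⌉₊) t = g n t := by
    intro n t ht
    exact huniq _ n (Nat.ceil_le.2 ht.2) ⟨ht.1, Nat.le_ceil t⟩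
  refine ⟨fun t => g (⌈t⌉₊) t, by simp [hg0], fun t ht => ?_⟩
  have htn : t < ((⌈t⌉₊ + 1 : ℕ) : ℝ) := by
    have := Nat.le_ceil t
    push_cast
    linarith
  have h1 := hg (⌈t⌉₊ + 1) t ⟨ht, htn.le⟩
  have h2 : HasDerivWithinAt (g (⌈t⌉₊ + 1)) (F (g (⌈t⌉₊ + 1) t)) (Ici 0) t := by
    refine h1.mono_of_mem_nhdsWithin ?_
    rw [mem_nhdsWithin]
    exact ⟨Iio _, isOpen_Iio, htn, fun s hs => ⟨hs.2, le_of_lt hs.1⟩⟩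
  simp only [hglue (⌈t⌉₊ + 1) t ⟨ht, htn.le⟩]
  refine h2.congr_of_eventuallyEq ?_ (hglue _ t ⟨ht, htn.le⟩)
  filter_upwards [mem_nhdsWithin_of_mem_nhds (Iio_mem_nhds htn), self_mem_nhdsWithin] with s hs hs0
  exact hglue _ s ⟨hs0, le_of_lt hs⟩

/-! ### The Nash equilibrium -/

theorem euclNorm_sq {N : ℕ} (v : Fin N → ℝ) : euclNorm v ^ 2 = ∑ i, v i ^ 2 := by
  simp [euclNorm, EuclideanSpace.norm_sq_eq]

theorem hasDerivAt_update_ownGrad {N : ℕ} {f : Fin N → (Fin N → ℝ) → ℝ}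
    (hf : SmoothLipschitz f) (i : Fin N) (y : Fin N → ℝ) (s : ℝ) :
    HasDerivAt (fun s => f i (Function.update y i s)) (ownGrad f i (Function.update y i s)) s := by
  have h1 : HasFDerivAt (f i) (fderiv ℝ (f i) (Function.update y i s)) (Function.update y i s) :=
    ((hf.1 i).differentiable one_ne_zero _).hasFDerivAt
  exact h1.comp_hasDerivAt s (hasDerivAt_update y i s)

/-- Strong monotonicity makes each objective convex in the player's own action, so the Nash
equilibria are exactly the zeros of the pseudo-gradient. -/
theorem isNash_iff {N : ℕ} {f : Fin N → (Fin N → ℝ) → ℝ} (hf : SmoothLipschitz f)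
    (hmono : StronglyMonotone f) (y : Fin N → ℝ) : IsNash f y ↔ ∀ i, ownGrad f i y = 0 := by
  constructor
  · intro h i
    have h1 := hasDerivAt_update_ownGrad hf i y (y i)
    rw [Function.update_eq_self] at h1
    refine IsLocalMin.hasDerivAt_eq_zero (Eventually.of_forall fun s => ?_) h1
    simpa using h i s
  · intro h i s
    obtain ⟨ω, hω, hm⟩ := hmono
    -- comparing `y` with a unilateral deviation leaves one term of the monotonicity sum
    have hsign : ∀ s : ℝ, 0 ≤ (s - y i) * ownGrad f i (Function.update y i s) := by
      intro s
      have h1 := hm (Function.update y i s) y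
      rw [Finset.sum_eq_single i (fun j _ hj => by simp [hj]) (by simp)] at h1
      simp only [Function.update_self, h i, sub_zero] at h1
      exact le_trans (by positivity) h1
    have hd := hasDerivAt_update_ownGrad hf i y
    have hc : Continuous fun s => f i (Function.update y i s) :=
      continuous_iff_continuousAt.2 fun s => (hd s).continuousAt
    have key : f i (Function.update y i (y i)) ≤ f i (Function.update y i s) := by
      rcases le_total (y i) s with hs | hs
      · refine monotoneOn_of_hasDerivWithinAt_nonneg (convex_Ici (y i)) hc.continuousOn
          (fun x _ => (hd x).hasDerivWithinAt) (fun x hx => ?_) self_mem_Ici hs hs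
        rw [interior_Ici] at hx
        exact nonneg_of_mul_nonneg_right (hsign x) (sub_pos.2 hx)
      · refine antitoneOn_of_hasDerivWithinAt_nonpos (convex_Iic (y i)) hc.continuousOn
          (fun x _ => (hd x).hasDerivWithinAt) (fun x hx => ?_) hs self_mem_Iic hs
        rw [interior_Iic] at hx
        have := hsign x
        have hx' : x - y i < 0 := sub_neg.2 hx
        by_contra hcon
        push Not at hcon
        linarith [mul_neg_of_neg_of_pos hx' hcon]
    rwa [Function.update_eq_self] at key

/-- A common Lipschitz constant for the partial gradients, for sums of squares. -/
theorem exists_ownGrad_sq_bound {N : ℕ} {f : Fin N → (Fin N → ℝ) → ℝ} (hf : SmoothLipschitz f) :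
    ∃ l : ℝ, 0 < l ∧ ∀ i (y z : Fin N → ℝ),
      (ownGrad f i y - ownGrad f i z) ^ 2 ≤ l * ∑ k, (y k - z k) ^ 2 := by
  choose l hl hL using hf.2
  refine ⟨1 + ∑ i, l i ^ 2, by positivity, fun i y z => ?_⟩
  have h1 := hL i y z
  have h2 : (ownGrad f i y - ownGrad f i z) ^ 2 ≤ (l i * euclNorm (y - z)) ^ 2 := by
    rw [← sq_abs]
    gcongr
  rw [mul_pow, euclNorm_sq] at h2
  refine h2.trans (mul_le_mul_of_nonneg_right ?_ (by positivity))
  have := Finset.single_le_sum (f := fun i => l i ^ 2) (fun i _ => sq_nonneg _)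
    (Finset.mem_univ i)
  linarith

/-- A strongly monotone Lipschitz pseudo-gradient has a zero: a short explicit gradient step is a
contraction. -/
theorem exists_ownGrad_eq_zero {N : ℕ} {f : Fin N → (Fin N → ℝ) → ℝ} (hf : SmoothLipschitz f)
    (hmono : StronglyMonotone f) : ∃ y, ∀ i, ownGrad f i y = 0 := by
  obtain ⟨ω, hω, hm⟩ := hmono
  obtain ⟨l, hl, hL⟩ := exists_ownGrad_sq_bound hf
  -- with step `τ = ω / S` the squared contraction factor is at most `1 - ω ^ 2 / S`, because `S`
  -- exceeds the squared Lipschitz constant `N * l`; the other summands make this number positive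
  set S := N * l + ω ^ 2 + 1 with hS
  have hS0 : 0 < S := by positivity
  have hωS : ω ^ 2 / S < 1 := by
    rw [div_lt_one hS0]
    have : 0 ≤ N * l := by positivity
    linarith
  have hωS0 : 0 < ω ^ 2 / S := by positivity
  set τ := ω / S with hτ
  let Φ : EuclideanSpace ℝ (Fin N) → EuclideanSpace ℝ (Fin N) := fun v =>
    WithLp.toLp 2 fun i => v i - τ * ownGrad f i v
  set K : ℝ≥0 := (√(1 - ω ^ 2 / S)).toNNReal
  have hK : (K : ℝ) = √(1 - ω ^ 2 / S) := Real.coe_toNNReal _ (Real.sqrt_nonneg _)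
  have hcontr : ContractingWith K Φ := by
    constructor
    · rw [← NNReal.coe_lt_coe, hK, NNReal.coe_one, Real.sqrt_lt' one_pos]
      linarith
    · refine LipschitzWith.of_dist_le_mul fun y z => ?_
      rw [hK, EuclideanSpace.dist_eq, EuclideanSpace.dist_eq, ← Real.sqrt_mul (by linarith)]
      refine Real.sqrt_le_sqrt ?_
      simp only [Real.dist_eq, sq_abs, Φ]
      set D := ∑ k, (y k - z k) ^ 2 with hD
      have h1 := hm y z
      rw [euclNorm_sq] at h1
      simp only [Pi.sub_apply] at h1
      rw [← hD] at h1
      have h2 : ∑ i, (ownGrad f i y - ownGrad f i z) ^ 2 ≤ N * (l * D) := by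
        refine (Finset.sum_le_sum fun i _ => hL i y z).trans ?_
        simp [hD]
      have hτ0 : 0 < τ := by positivity
      have hD0 : 0 ≤ D := by positivity
      calc ∑ i, (y i - τ * ownGrad f i y - (z i - τ * ownGrad f i z)) ^ 2
          = D - 2 * τ * (∑ i, (y i - z i) * (ownGrad f i y - ownGrad f i z))
            + τ ^ 2 * ∑ i, (ownGrad f i y - ownGrad f i z) ^ 2 := by
            rw [hD, Finset.mul_sum, Finset.mul_sum, ← Finset.sum_sub_distrib,
              ← Finset.sum_add_distrib]
            exact Finset.sum_congr rfl fun i _ => by ring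
        _ ≤ D - 2 * τ * (ω * D) + τ ^ 2 * (N * (l * D)) := by gcongr
        _ ≤ D - 2 * τ * (ω * D) + τ ^ 2 * (S * D) := by
            have : N * (l * D) ≤ S * D := by
              rw [← mul_assoc]
              refine mul_le_mul_of_nonneg_right ?_ hD0
              rw [hS]
              nlinarith
            gcongr
        _ = (1 - ω ^ 2 / S) * D := by
            rw [hτ]
            field_simp
            ring
  obtain ⟨y, hy⟩ : ∃ y, Φ y = y := ⟨_, hcontr.fixedPoint_isFixedPt⟩
  refine ⟨y, fun i => ?_⟩
  have h1 := congrArg (fun v : EuclideanSpace ℝ (Fin N) => v i) hy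
  simp only [Φ] at h1
  have hτ0 : τ ≠ 0 := by positivity
  have h2 : τ * ownGrad f i y = 0 := by linarith
  exact (mul_eq_zero.1 h2).resolve_left hτ0

theorem existsUnique_isNash {N : ℕ} {f : Fin N → (Fin N → ℝ) → ℝ} (hf : SmoothLipschitz f)
    (hmono : StronglyMonotone f) : ∃! y : Fin N → ℝ, IsNash f y := by
  obtain ⟨y, hy⟩ := exists_ownGrad_eq_zero hf hmono
  refine ⟨y, (isNash_iff hf hmono y).2 hy, fun z hz => ?_⟩
  replace hz := (isNash_iff hf hmono z).1 hz
  obtain ⟨ω, hω, hm⟩ := hmono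
  have h1 := hm z y
  simp only [hz, hy, sub_self, mul_zero, Finset.sum_const_zero] at h1
  have h2 : euclNorm (z - y) ^ 2 = 0 :=
    le_antisymm (nonpos_of_mul_nonpos_right h1 hω) (sq_nonneg _)
  rw [euclNorm_sq, Finset.sum_eq_zero_iff_of_nonneg fun i _ => sq_nonneg _] at h2
  funext i
  have h3 := h2 i (Finset.mem_univ i)
  simp only [Pi.sub_apply] at h3
  linarith [pow_eq_zero_iff two_ne_zero |>.1 h3]

/-! ### The consensus operator of a strongly connected digraph -/

/-- The graph Laplacian of a strongly connected weighted digraph has a positive left null vector.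
It is obtained as the entrywise absolute value of any nonzero left null vector. -/
theorem exists_pos_left_null {N : ℕ} (hN : 1 < N) {a : Matrix (Fin N) (Fin N) ℝ}
    (ha : IsAdjacency a) (hconn : StronglyConnected a) :
    ∃ r : Fin N → ℝ, (∀ i, 0 < r i) ∧ ∀ k, ∑ i, r i * a i k = r k * ∑ i, a k i := by
  set L : Matrix (Fin N) (Fin N) ℝ := Matrix.diagonal (fun k => ∑ i, a k i) - a with hL
  have hdet : L.det = 0 := by
    refine Matrix.exists_mulVec_eq_zero_iff.1 ⟨fun _ => 1, ?_, ?_⟩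
    · intro h
      simpa using congrFun h ⟨0, by omega⟩
    · funext k
      rw [hL, Matrix.sub_mulVec, Pi.sub_apply, Matrix.mulVec_diagonal]
      simp [Matrix.mulVec, dotProduct]
  obtain ⟨s, hs0, hs⟩ := Matrix.exists_vecMul_eq_zero_iff.2 hdet
  have hs' : ∀ k, ∑ i, s i * a i k = s k * ∑ i, a k i := by
    intro k
    have h := congrFun hs k
    rw [hL, Matrix.vecMul_sub, Pi.sub_apply, Matrix.vecMul_diagonal] at h
    simp only [Pi.zero_apply, Matrix.vecMul, dotProduct] at h
    linarith
  -- the triangle inequality for `|s|` is an equality because both sides have the same sum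
  have hle : ∀ k, |s k| * ∑ i, a k i ≤ ∑ i, |s i| * a i k := by
    intro k
    have h0 : 0 ≤ ∑ i, a k i := Finset.sum_nonneg fun i _ => ha.1 k i
    calc |s k| * ∑ i, a k i = |∑ i, s i * a i k| := by rw [hs', abs_mul, abs_of_nonneg h0]
      _ ≤ ∑ i, |s i * a i k| := Finset.abs_sum_le_sum_abs _ _
      _ = ∑ i, |s i| * a i k := by simp_rw [abs_mul, abs_of_nonneg (ha.1 _ _)]
  have hsum : ∑ k, |s k| * ∑ i, a k i = ∑ k, ∑ i, |s i| * a i k := by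
    rw [Finset.sum_comm]
    simp_rw [Finset.mul_sum]
  have heq : ∀ k, ∑ i, |s i| * a i k = |s k| * ∑ i, a k i := fun k =>
    ((Finset.sum_eq_sum_iff_of_le fun k _ => hle k).1 hsum k (Finset.mem_univ k)).symm
  refine ⟨fun i => |s i|, fun k => ?_, heq⟩
  by_contra hk
  have hk0 : s k = 0 := by simpa using hk
  have hstep : ∀ p q, s p = 0 → 0 < a q p → s q = 0 := by
    intro p q hp hqp
    have h := heq p
    rw [hp, abs_zero, zero_mul,
      Finset.sum_eq_zero_iff_of_nonneg fun i _ => mul_nonneg (abs_nonneg _) (ha.1 i p)] at h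
    have := h q (Finset.mem_univ q)
    rcases mul_eq_zero.1 this with h | h
    · simpa using h
    · exact absurd h hqp.ne'
  refine hs0 (funext fun i => ?_)
  by_cases hik : k = i
  · rw [← hik, hk0, Pi.zero_apply]
  · have hpath := hconn k i hik
    induction hpath with
    | single h => exact hstep _ _ hk0 h
    | @tail b c _ h ih =>
      by_cases hb : k = b
      · exact hstep _ _ (hb ▸ hk0) h
      · exact hstep _ _ (ih hb) h

/-- The linear operator that maps the estimation errors `η i j` to the local consensus errors. -/
noncomputable def consOp {N : ℕ} (a : Matrix (Fin N) (Fin N) ℝ) (η : Fin N → Fin N → ℝ)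
    (i j : Fin N) : ℝ :=
  ∑ k, a i k * (η i j - η k j) + a i j * η i j

theorem consErr_eq_consOp {N : ℕ} (a : Matrix (Fin N) (Fin N) ℝ) (z : Fin N → Fin N → ℝ)
    (w : Fin N → ℝ) (i j : Fin N) :
    consErr a z w i j = consOp a (fun p q => z p q + w q) i j := by
  simp [consErr, consOp]

/-- The left null vector cancels the difference of squares, which leaves a sum of squares over the
edges and over the direct observations of `j`. -/
theorem sum_mul_consOp {N : ℕ} {a : Matrix (Fin N) (Fin N) ℝ} {r : Fin N → ℝ}
    (hr : ∀ k, ∑ i, r i * a i k = r k * ∑ i, a k i) (η : Fin N → Fin N → ℝ) (j : Fin N) :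
    ∑ i, r i * η i j * consOp a η i j =
      (∑ i, ∑ k, r i * a i k * (η i j - η k j) ^ 2) / 2 + ∑ i, r i * a i j * η i j ^ 2 := by
  have h1 : ∑ i, ∑ k, r i * a i k * η k j ^ 2 = ∑ i, ∑ k, r i * a i k * η i j ^ 2 := by
    rw [Finset.sum_comm]
    refine Finset.sum_congr rfl fun k _ => ?_
    rw [← Finset.sum_mul, hr, ← Finset.sum_mul, Finset.mul_sum]
  have h2 : ∑ i, ∑ k, r i * a i k * (η i j - η k j) ^ 2 =
      2 * ∑ i, ∑ k, r i * η i j * (a i k * (η i j - η k j))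
        + (∑ i, ∑ k, r i * a i k * η k j ^ 2 - ∑ i, ∑ k, r i * a i k * η i j ^ 2) := by
    simp only [Finset.mul_sum, ← Finset.sum_add_distrib, ← Finset.sum_sub_distrib]
    exact Finset.sum_congr rfl fun i _ => Finset.sum_congr rfl fun k _ => by ring
  rw [h2, h1, sub_self, add_zero, mul_div_cancel_left₀ _ two_ne_zero, ← Finset.sum_add_distrib]
  refine Finset.sum_congr rfl fun i _ => ?_
  rw [consOp, mul_add, Finset.mul_sum]
  ring

/-- Some node observes `j` directly. This needs a second node. -/
theorem exists_observer {N : ℕ} (hN : 1 < N) {a : Matrix (Fin N) (Fin N) ℝ}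
    (hconn : StronglyConnected a) (j : Fin N) : ∃ i, 0 < a i j := by
  obtain ⟨q, hq⟩ : ∃ q : Fin N, j ≠ q := by
    have : Nontrivial (Fin N) := Fin.nontrivial_iff_two_le.2 hN
    obtain ⟨q, hq⟩ := exists_ne j
    exact ⟨q, hq.symm⟩
  obtain ⟨i, hi, _⟩ := Relation.TransGen.head'_iff.1 (hconn j q hq)
  exact ⟨i, hi⟩

/-- A homogeneous quadratic continuous function that is positive away from zero dominates the sum
of squares. -/
theorem exists_coercive {N : ℕ} {Q : (Fin N → Fin N → ℝ) → ℝ} (hQ : Continuous Q)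
    (hhom : ∀ (t : ℝ) η, Q (t • η) = t ^ 2 * Q η) (hpos : ∀ η, η ≠ 0 → 0 < Q η) :
    ∃ lam : ℝ, 0 < lam ∧ ∀ η, lam * ∑ i, ∑ j, η i j ^ 2 ≤ Q η := by
  obtain ⟨μ, hμ, hμQ⟩ := (isCompact_sphere (0 : Fin N → Fin N → ℝ) 1).exists_forall_le'
    hQ.continuousOn (a := 0) (fun η hη => hpos η fun h => by simp [h] at hη)
  refine ⟨μ / (N * N + 1), by positivity, fun η => ?_⟩
  by_cases hη : η = 0
  · have hQ0 : Q 0 = 0 := by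
      have := hhom 0 0
      rwa [zero_smul, zero_pow two_ne_zero, zero_mul] at this
    rw [hη, hQ0]
    simp
  · have hn : ‖η‖ ≠ 0 := norm_ne_zero_iff.2 hη
    have h1 : μ * ‖η‖ ^ 2 ≤ Q η := by
      have h2 := hμQ (‖η‖⁻¹ • η) (by simp [norm_smul, hn])
      rw [hhom] at h2
      have h3 := mul_le_mul_of_nonneg_left h2 (sq_nonneg ‖η‖)
      have h4 : ‖η‖ ^ 2 * (‖η‖⁻¹ ^ 2 * Q η) = Q η := by field_simp
      linarith
    have h5 : ∑ i, ∑ j, η i j ^ 2 ≤ (N * N + 1) * ‖η‖ ^ 2 := by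
      have h6 : ∀ i j, η i j ^ 2 ≤ ‖η‖ ^ 2 := fun i j => by
        rw [← sq_abs]
        gcongr
        exact (norm_le_pi_norm (η i) j).trans (norm_le_pi_norm η i)
      calc ∑ i, ∑ j, η i j ^ 2 ≤ ∑ _i : Fin N, ∑ _j : Fin N, ‖η‖ ^ 2 :=
            Finset.sum_le_sum fun i _ => Finset.sum_le_sum fun j _ => h6 i j
        _ = N * N * ‖η‖ ^ 2 := by simp; ring
        _ ≤ (N * N + 1) * ‖η‖ ^ 2 := by gcongr; linarith
    calc μ / (N * N + 1) * ∑ i, ∑ j, η i j ^ 2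
        ≤ μ / (N * N + 1) * ((N * N + 1) * ‖η‖ ^ 2) := by gcongr
      _ = μ * ‖η‖ ^ 2 := by field_simp
      _ ≤ Q η := h1

/-- Weighted by the left null vector of the Laplacian, the consensus operator is positive
definite, although it is not symmetric. -/
theorem exists_consOp_coercive {N : ℕ} (hN : 1 < N) {a : Matrix (Fin N) (Fin N) ℝ}
    (ha : IsAdjacency a) (hconn : StronglyConnected a) {r : Fin N → ℝ} (hr0 : ∀ i, 0 < r i)
    (hr : ∀ k, ∑ i, r i * a i k = r k * ∑ i, a k i) :
    ∃ lam : ℝ, 0 < lam ∧ ∀ η : Fin N → Fin N → ℝ,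
      lam * ∑ i, ∑ j, η i j ^ 2 ≤ ∑ i, ∑ j, r i * η i j * consOp a η i j := by
  refine exists_coercive (Q := fun η => ∑ i, ∑ j, r i * η i j * consOp a η i j) ?_ ?_ ?_
  · unfold consOp
    fun_prop
  · intro t η
    simp only [Finset.mul_sum]
    refine Finset.sum_congr rfl fun i _ => Finset.sum_congr rfl fun j _ => ?_
    have : consOp a (t • η) i j = t * consOp a η i j := by
      simp only [consOp, Pi.smul_apply, smul_eq_mul, mul_add, Finset.mul_sum]
      congr 1
      · exact Finset.sum_congr rfl fun k _ => by ring
      · ring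
    rw [this]
    simp only [Pi.smul_apply, smul_eq_mul]
    ring
  · intro η hη
    rw [Finset.sum_comm]
    simp only [sum_mul_consOp hr]
    have hA : ∀ j i k, 0 ≤ r i * a i k * (η i j - η k j) ^ 2 := fun j i k =>
      mul_nonneg (mul_nonneg (hr0 i).le (ha.1 i k)) (sq_nonneg _)
    have hB : ∀ j i, 0 ≤ r i * a i j * η i j ^ 2 := fun j i =>
      mul_nonneg (mul_nonneg (hr0 i).le (ha.1 i j)) (sq_nonneg _)
    have hA1 : ∀ j i, 0 ≤ ∑ k, r i * a i k * (η i j - η k j) ^ 2 := fun j i =>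
      Finset.sum_nonneg fun k _ => hA j i k
    have hA2 : ∀ j, 0 ≤ (∑ i, ∑ k, r i * a i k * (η i j - η k j) ^ 2) / 2 := fun j =>
      div_nonneg (Finset.sum_nonneg fun i _ => hA1 j i) zero_le_two
    have hB1 : ∀ j, 0 ≤ ∑ i, r i * a i j * η i j ^ 2 := fun j =>
      Finset.sum_nonneg fun i _ => hB j i
    refine lt_of_le_of_ne (Finset.sum_nonneg fun j _ => add_nonneg (hA2 j) (hB1 j)) fun h0 => hη ?_
    have h1 := fun j => (Finset.sum_eq_zero_iff_of_nonneg
      (fun j _ => add_nonneg (hA2 j) (hB1 j))).1 h0.symm j (Finset.mem_univ j)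
    -- the errors agree along every edge and vanish at the nodes that observe `j` directly
    have hedge : ∀ j p q, 0 < a q p → η q j = η p j := by
      intro j p q hqp
      have h2 : ∑ i, ∑ k, r i * a i k * (η i j - η k j) ^ 2 = 0 := by
        linarith [h1 j, hA2 j, hB1 j]
      have h3 := (Finset.sum_eq_zero_iff_of_nonneg (fun i _ => hA1 j i)).1 h2 q (Finset.mem_univ q)
      have h4 := (Finset.sum_eq_zero_iff_of_nonneg (fun k _ => hA j q k)).1 h3 p (Finset.mem_univ p)
      have h5 := (mul_eq_zero.1 h4).resolve_left (mul_pos (hr0 q) hqp).ne'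
      linarith [pow_eq_zero_iff two_ne_zero |>.1 h5]
    funext i j
    obtain ⟨p, hp⟩ := exists_observer hN hconn j
    have hzero : η p j = 0 := by
      have h2 : ∑ i, r i * a i j * η i j ^ 2 = 0 := by linarith [h1 j, hA2 j, hB1 j]
      have h3 := (Finset.sum_eq_zero_iff_of_nonneg (fun i _ => hB j i)).1 h2 p (Finset.mem_univ p)
      have h5 := (mul_eq_zero.1 h3).resolve_left (mul_pos (hr0 p) hp).ne'
      exact pow_eq_zero_iff two_ne_zero |>.1 h5
    by_cases hpi : p = i
    · rw [← hpi, hzero]; rfl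
    · have hpath := hconn p i hpi
      have : η i j = η p j := by
        clear hpi
        induction hpath with
        | single h => exact hedge j _ _ h
        | tail _ h ih => exact (hedge j _ _ h).trans ih
      rw [this, hzero]; rfl

/-- The consensus operator is injective, with a quantitative bound on its inverse. -/
theorem exists_sum_sq_le_consOp {N : ℕ} {a : Matrix (Fin N) (Fin N) ℝ} {r : Fin N → ℝ} {lam : ℝ}
    (hlam : 0 < lam)
    (h : ∀ η : Fin N → Fin N → ℝ,
      lam * ∑ i, ∑ j, η i j ^ 2 ≤ ∑ i, ∑ j, r i * η i j * consOp a η i j) :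
    ∃ C : ℝ, 0 < C ∧ ∀ η : Fin N → Fin N → ℝ,
      ∑ i, ∑ j, η i j ^ 2 ≤ C * ∑ i, ∑ j, consOp a η i j ^ 2 := by
  refine ⟨(1 + ∑ i, r i ^ 2) / lam ^ 2, by positivity, fun η => ?_⟩
  have h1 : ∑ i, ∑ j, r i * η i j * consOp a η i j ≤
      ∑ i, ∑ j, (lam / 2 * η i j ^ 2 + (1 + ∑ i, r i ^ 2) / (2 * lam) * consOp a η i j ^ 2) := by
    refine Finset.sum_le_sum fun i _ => Finset.sum_le_sum fun j _ => ?_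
    have hri : r i ^ 2 ≤ 1 + ∑ i, r i ^ 2 := by
      have := Finset.single_le_sum (f := fun i => r i ^ 2) (fun i _ => sq_nonneg _)
        (Finset.mem_univ i)
      linarith
    have h2 : r i ^ 2 / (2 * lam) * consOp a η i j ^ 2 ≤
        (1 + ∑ i, r i ^ 2) / (2 * lam) * consOp a η i j ^ 2 := by gcongr
    have h3 : lam / 2 * η i j ^ 2 + r i ^ 2 / (2 * lam) * consOp a η i j ^ 2
        - r i * η i j * consOp a η i j = (lam * η i j - r i * consOp a η i j) ^ 2 / (2 * lam) := by
      field_simp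
      ring
    have h4 : 0 ≤ (lam * η i j - r i * consOp a η i j) ^ 2 / (2 * lam) := by positivity
    linarith
  have h5 := (h η).trans h1
  simp only [Finset.sum_add_distrib, ← Finset.mul_sum] at h5
  rw [div_mul_eq_mul_div, le_div_iff₀ (by positivity)]
  have h6 : (1 + ∑ i, r i ^ 2) / (2 * lam) * (∑ i, ∑ j, consOp a η i j ^ 2) * (2 * lam) =
      (1 + ∑ i, r i ^ 2) * ∑ i, ∑ j, consOp a η i j ^ 2 := by field_simp
  nlinarith

/-! ### The Lyapunov function of the estimation subsystem -/

/-- States `(z, c, w)` of the gradient-estimation subsystem: the estimates, the adaptive gains and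
the gradient integrals. -/
abbrev EstState (N : ℕ) : Type :=
  (Fin N → Fin N → ℝ) × (Fin N → Fin N → ℝ) × (Fin N → ℝ)

/-- The autonomous vector field of the gradient-estimation subsystem, in which the gradient
integrals are state variables. -/
noncomputable def estField {N : ℕ} (f : Fin N → (Fin N → ℝ) → ℝ) (a : Matrix (Fin N) (Fin N) ℝ)
    (s : EstState N) : EstState N :=
  (fun i j => -(s.2.1 i j + consErr a s.1 s.2.2 i j ^ 2) * consErr a s.1 s.2.2 i j,
    fun i j => consErr a s.1 s.2.2 i j ^ 2,
    fun j => ownGrad f j (s.1 j))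

/-- The Lyapunov function of the estimation subsystem; `b` is the reference value of the adaptive
gains and `K` weighs the squared distance of `-w` from the equilibrium. -/
noncomputable def lyap {N : ℕ} (a : Matrix (Fin N) (Fin N) ℝ) (r ystar : Fin N → ℝ) (K b : ℝ)
    (s : EstState N) : ℝ :=
  ∑ i, ∑ j, r i * (s.2.1 i j * consErr a s.1 s.2.2 i j ^ 2 + consErr a s.1 s.2.2 i j ^ 4 / 2
      + (s.2.1 i j - b) ^ 2 / 2)
    + K / 2 * ∑ j, (s.2.2 j + ystar j) ^ 2

/-- The derivative of `lyap` along `estField`. -/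
noncomputable def lyapDeriv {N : ℕ} (f : Fin N → (Fin N → ℝ) → ℝ) (a : Matrix (Fin N) (Fin N) ℝ)
    (r ystar : Fin N → ℝ) (K b : ℝ) (s : EstState N) : ℝ :=
  ∑ i, ∑ j, r i * (2 * ((s.2.1 i j + consErr a s.1 s.2.2 i j ^ 2) * consErr a s.1 s.2.2 i j) *
        (a i j * ownGrad f j (s.1 j) - consOp a (fun p q =>
          (s.2.1 p q + consErr a s.1 s.2.2 p q ^ 2) * consErr a s.1 s.2.2 p q) i j)
      + (s.2.1 i j + consErr a s.1 s.2.2 i j ^ 2) * consErr a s.1 s.2.2 i j ^ 2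
      - b * consErr a s.1 s.2.2 i j ^ 2)
    + K * ∑ j, (s.2.2 j + ystar j) * ownGrad f j (s.1 j)

/-- The part of the state that the Lyapunov argument drives to zero. -/
noncomputable def residual {N : ℕ} (a : Matrix (Fin N) (Fin N) ℝ) (ystar : Fin N → ℝ)
    (s : EstState N) : ℝ :=
  ∑ j, (s.2.2 j + ystar j) ^ 2 + ∑ i, ∑ j, consErr a s.1 s.2.2 i j ^ 2

theorem residual_nonneg {N : ℕ} (a : Matrix (Fin N) (Fin N) ℝ) (ystar : Fin N → ℝ)
    (s : EstState N) : 0 ≤ residual a ystar s := by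
  unfold residual
  positivity

theorem hasDerivWithinAt_consErr {N : ℕ} (a : Matrix (Fin N) (Fin N) ℝ)
    {z : ℝ → Fin N → Fin N → ℝ} {w : ℝ → Fin N → ℝ} {z' : Fin N → Fin N → ℝ} {w' : Fin N → ℝ}
    {S : Set ℝ} {t : ℝ} (hz : HasDerivWithinAt z z' S t) (hw : HasDerivWithinAt w w' S t)
    (i j : Fin N) :
    HasDerivWithinAt (fun t => consErr a (z t) (w t) i j) (consErr a z' w' i j) S t := by
  have hz' : ∀ p q, HasDerivWithinAt (fun t => z t p q) (z' p q) S t := fun p q =>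
    hasDerivWithinAt_pi.1 (hasDerivWithinAt_pi.1 hz p) q
  have hw' : ∀ q, HasDerivWithinAt (fun t => w t q) (w' q) S t := hasDerivWithinAt_pi.1 hw
  unfold consErr
  exact (HasDerivWithinAt.fun_sum fun k _ => ((hz' i j).sub (hz' k j)).const_mul (a i k)).add
    (((hz' i j).add (hw' j)).const_mul (a i j))

/-- On columns that are constant the consensus operator only sees the direct observations. -/
theorem consOp_shift {N : ℕ} (a : Matrix (Fin N) (Fin N) ℝ) (k : ℝ) (g : Fin N → ℝ)
    (η : Fin N → Fin N → ℝ) (i j : Fin N) :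
    consOp a (fun p q => k * (g q - η p q)) i j = k * (a i j * g j - consOp a η i j) := by
  have h : ∑ p, a i p * (k * (g j - η i j) - k * (g j - η p j)) =
      -k * ∑ p, a i p * (η i j - η p j) := by
    rw [Finset.mul_sum]
    exact Finset.sum_congr rfl fun p _ => by ring
  rw [consOp, consOp, h]
  ring

theorem hasDerivWithinAt_lyap {N : ℕ} (f : Fin N → (Fin N → ℝ) → ℝ)
    (a : Matrix (Fin N) (Fin N) ℝ) (r ystar : Fin N → ℝ) (K b : ℝ) {γ : ℝ → EstState N} {k : ℝ}
    {S : Set ℝ} {t : ℝ} (hγ : HasDerivWithinAt γ (k • estField f a (γ t)) S t) :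
    HasDerivWithinAt (fun t => lyap a r ystar K b (γ t))
      (k * lyapDeriv f a r ystar K b (γ t)) S t := by
  have hz := hγ.fst
  have hc := hγ.snd.fst
  have hw := hγ.snd.snd
  have hξ := hasDerivWithinAt_consErr a hz hw
  have hc' : ∀ p q, HasDerivWithinAt (fun t => (γ t).2.1 p q)
      ((k • estField f a (γ t)).2.1 p q) S t := fun p q =>
    hasDerivWithinAt_pi.1 (hasDerivWithinAt_pi.1 hc p) q
  have hw' : ∀ q, HasDerivWithinAt (fun t => (γ t).2.2 q)
      ((k • estField f a (γ t)).2.2 q) S t := hasDerivWithinAt_pi.1 hw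
  have h1 := (HasDerivWithinAt.fun_sum fun i (_ : i ∈ Finset.univ) =>
    HasDerivWithinAt.fun_sum fun j (_ : j ∈ Finset.univ) =>
      ((((hc' i j).fun_mul ((hξ i j).fun_pow 2)).fun_add (((hξ i j).fun_pow 4).div_const 2)).fun_add
        ((((hc' i j).sub_const b).fun_pow 2).div_const 2)).const_mul (r i)).fun_add
    ((HasDerivWithinAt.fun_sum fun j (_ : j ∈ Finset.univ) =>
      ((hw' j).add_const (ystar j)).fun_pow 2).const_mul (K / 2))
  unfold lyap
  refine h1.congr_deriv ?_
  unfold lyapDeriv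
  rw [mul_add]
  simp only [Finset.mul_sum]
  congr 1
  · refine Finset.sum_congr rfl fun i _ => ?_
    refine Finset.sum_congr rfl fun j _ => ?_
    have hξ' : consErr a (k • estField f a (γ t)).1 (k • estField f a (γ t)).2.2 i j =
        k * (a i j * ownGrad f j ((γ t).1 j) - consOp a (fun p q =>
          ((γ t).2.1 p q + consErr a (γ t).1 (γ t).2.2 p q ^ 2)
            * consErr a (γ t).1 (γ t).2.2 p q) i j) := by
      rw [consErr_eq_consOp]
      refine Eq.trans ?_ (consOp_shift a k (fun q => ownGrad f q ((γ t).1 q)) _ i j)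
      congr 1
      funext p q
      simp only [estField, Prod.smul_fst, Prod.smul_snd, Pi.smul_apply, smul_eq_mul]
      ring
    rw [hξ']
    simp only [estField, Prod.smul_fst, Prod.smul_snd, Pi.smul_apply, smul_eq_mul]
    push_cast
    ring
  · refine Finset.sum_congr rfl fun j _ => ?_
    simp only [estField, Prod.smul_snd, Pi.smul_apply, smul_eq_mul]
    push_cast
    ring

/-- The total squared gradient and the work term are controlled by the distance of `-w` from the
equilibrium and by the estimation errors. -/
theorem ownGrad_estimates {N : ℕ} {f : Fin N → (Fin N → ℝ) → ℝ} {l ω : ℝ} (hω : 0 < ω)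
    (hL : ∀ i (y z : Fin N → ℝ),
      (ownGrad f i y - ownGrad f i z) ^ 2 ≤ l * ∑ k, (y k - z k) ^ 2)
    (hm : ∀ y z : Fin N → ℝ,
      ω * euclNorm (y - z) ^ 2 ≤ ∑ i, (y i - z i) * (ownGrad f i y - ownGrad f i z))
    {ystar : Fin N → ℝ} (hy : ∀ i, ownGrad f i ystar = 0) (z : Fin N → Fin N → ℝ)
    (w : Fin N → ℝ) :
    ∑ j, ownGrad f j (z j) ^ 2 ≤ 2 * l * ∑ i, ∑ j, (z i j + w j) ^ 2
        + 2 * N * l * ∑ j, (w j + ystar j) ^ 2 ∧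
      ∑ j, (w j + ystar j) * ownGrad f j (z j) ≤ -(ω / 2) * ∑ j, (w j + ystar j) ^ 2
        + l / (2 * ω) * ∑ i, ∑ j, (z i j + w j) ^ 2 := by
  have h1 : ∀ j, (ownGrad f j (z j) - ownGrad f j (fun k => -w k)) ^ 2 ≤
      l * ∑ k, (z j k + w k) ^ 2 := fun j => by
    simpa using hL j (z j) (fun k => -w k)
  have h2 : ∀ j, ownGrad f j (fun k => -w k) ^ 2 ≤ l * ∑ k, (w k + ystar k) ^ 2 := fun j => by
    have h := hL j (fun k => -w k) ystar
    rw [hy, sub_zero] at h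
    refine h.trans (le_of_eq ?_)
    congr 1
    exact Finset.sum_congr rfl fun k _ => by ring
  constructor
  · calc ∑ j, ownGrad f j (z j) ^ 2
        ≤ ∑ j, (2 * (l * ∑ k, (z j k + w k) ^ 2) + 2 * (l * ∑ k, (w k + ystar k) ^ 2)) := by
          refine Finset.sum_le_sum fun j _ => ?_
          nlinarith [h1 j, h2 j, sq_nonneg (ownGrad f j (z j) - 2 * ownGrad f j (fun k => -w k))]
      _ = _ := by
          rw [Finset.sum_add_distrib, ← Finset.mul_sum, ← Finset.mul_sum]
          simp
          ring
  · have h3 := hm (fun k => -w k) ystar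
    rw [euclNorm_sq] at h3
    simp only [hy, Pi.sub_apply, sub_zero] at h3
    have h4 : ∑ k, (-w k - ystar k) ^ 2 = ∑ k, (w k + ystar k) ^ 2 :=
      Finset.sum_congr rfl fun k _ => by ring
    have h5 : ∑ i, (-w i - ystar i) * ownGrad f i (fun k => -w k) =
        -∑ i, (w i + ystar i) * ownGrad f i (fun k => -w k) := by
      rw [← Finset.sum_neg_distrib]
      exact Finset.sum_congr rfl fun k _ => by ring
    rw [h4, h5] at h3
    have h6 : ∑ j, (w j + ystar j) * (ownGrad f j (z j) - ownGrad f j (fun k => -w k)) ≤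
        ∑ j, (ω / 2 * (w j + ystar j) ^ 2 + 1 / (2 * ω) * (l * ∑ k, (z j k + w k) ^ 2)) := by
      refine Finset.sum_le_sum fun j _ => ?_
      set p := w j + ystar j
      set q := ownGrad f j (z j) - ownGrad f j (fun k => -w k) with hq
      have h7 : 1 / (2 * ω) * q ^ 2 ≤ 1 / (2 * ω) * (l * ∑ k, (z j k + w k) ^ 2) :=
        mul_le_mul_of_nonneg_left (h1 j) (by positivity)
      have h8 : ω / 2 * p ^ 2 + 1 / (2 * ω) * q ^ 2 - p * q = (ω * p - q) ^ 2 / (2 * ω) := by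
        field_simp
        ring
      have h9 : 0 ≤ (ω * p - q) ^ 2 / (2 * ω) := by positivity
      linarith
    rw [Finset.sum_add_distrib, ← Finset.mul_sum, ← Finset.mul_sum, ← Finset.mul_sum] at h6
    have h10 : ∑ j, (w j + ystar j) * ownGrad f j (z j) =
        ∑ j, (w j + ystar j) * (ownGrad f j (z j) - ownGrad f j (fun k => -w k))
          + ∑ i, (w i + ystar i) * ownGrad f i (fun k => -w k) := by
      rw [← Finset.sum_add_distrib]
      exact Finset.sum_congr rfl fun k _ => by ring
    rw [h10]
    have h11 : 1 / (2 * ω) * (l * ∑ i, ∑ j, (z i j + w j) ^ 2) =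
        l / (2 * ω) * ∑ i, ∑ j, (z i j + w j) ^ 2 := by ring
    linarith

/-- The consensus part of `lyapDeriv`: the cross terms are absorbed by the coercivity of the
consensus operator, at the price of a multiple of the squared errors and squared gradients. -/
theorem consensus_estimate {N : ℕ} {a : Matrix (Fin N) (Fin N) ℝ} {r : Fin N → ℝ} {lam : ℝ}
    (hlam : 0 < lam)
    (hco : ∀ η : Fin N → Fin N → ℝ,
      lam * ∑ i, ∑ j, η i j ^ 2 ≤ ∑ i, ∑ j, r i * η i j * consOp a η i j) :
    ∃ A B : ℝ, 0 ≤ A ∧ 0 ≤ B ∧ ∀ (c ξ : Fin N → Fin N → ℝ) (g : Fin N → ℝ),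
      ∑ i, ∑ j, r i * (2 * ((c i j + ξ i j ^ 2) * ξ i j) *
          (a i j * g j - consOp a (fun p q => (c p q + ξ p q ^ 2) * ξ p q) i j)
        + (c i j + ξ i j ^ 2) * ξ i j ^ 2) ≤
      A * ∑ j, g j ^ 2 + B * ∑ i, ∑ j, ξ i j ^ 2 := by
  refine ⟨N * (2 * (∑ i, ∑ j, (r i * a i j) ^ 2) / lam), (∑ i, r i ^ 2) / (2 * lam),
    by positivity, by positivity, fun c ξ g => ?_⟩
  set η : Fin N → Fin N → ℝ := fun p q => (c p q + ξ p q ^ 2) * ξ p q with hη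
  have hterm : ∀ i j, r i * (2 * η i j * (a i j * g j - consOp a η i j)
        + (c i j + ξ i j ^ 2) * ξ i j ^ 2) ≤
      lam * η i j ^ 2 - 2 * (r i * η i j * consOp a η i j)
        + 2 * (∑ i, ∑ j, (r i * a i j) ^ 2) / lam * g j ^ 2
        + (∑ i, r i ^ 2) / (2 * lam) * ξ i j ^ 2 := by
    intro i j
    have hra : (r i * a i j) ^ 2 ≤ ∑ i, ∑ j, (r i * a i j) ^ 2 :=
      (Finset.single_le_sum (f := fun j => (r i * a i j) ^ 2) (fun j _ => sq_nonneg _)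
        (Finset.mem_univ j)).trans
      (Finset.single_le_sum (f := fun i => ∑ j, (r i * a i j) ^ 2)
        (fun i _ => Finset.sum_nonneg fun j _ => sq_nonneg _) (Finset.mem_univ i))
    have hri : r i ^ 2 ≤ ∑ i, r i ^ 2 :=
      Finset.single_le_sum (f := fun i => r i ^ 2) (fun i _ => sq_nonneg _) (Finset.mem_univ i)
    have h1 : 2 * (r i * a i j) ^ 2 / lam * g j ^ 2 ≤
        2 * (∑ i, ∑ j, (r i * a i j) ^ 2) / lam * g j ^ 2 := by gcongr
    have h2 : r i ^ 2 / (2 * lam) * ξ i j ^ 2 ≤ (∑ i, r i ^ 2) / (2 * lam) * ξ i j ^ 2 := by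
      gcongr
    have h3 : lam / 2 * η i j ^ 2 + 2 * (r i * a i j) ^ 2 / lam * g j ^ 2
        - 2 * r i * η i j * (a i j * g j) =
        (lam * η i j - 2 * (r i * a i j) * g j) ^ 2 / (2 * lam) := by
      field_simp
      ring
    have h4 : lam / 2 * η i j ^ 2 + r i ^ 2 / (2 * lam) * ξ i j ^ 2
        - r i * ((c i j + ξ i j ^ 2) * ξ i j ^ 2) =
        (lam * η i j - r i * ξ i j) ^ 2 / (2 * lam) := by
      simp only [hη]
      field_simp
      ring
    have h5 : 0 ≤ (lam * η i j - 2 * (r i * a i j) * g j) ^ 2 / (2 * lam) := by positivity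
    have h6 : 0 ≤ (lam * η i j - r i * ξ i j) ^ 2 / (2 * lam) := by positivity
    linarith
  refine (Finset.sum_le_sum fun i _ => Finset.sum_le_sum fun j _ => hterm i j).trans ?_
  simp only [Finset.sum_add_distrib, Finset.sum_sub_distrib, ← Finset.mul_sum]
  have h7 := hco η
  have h8 : 0 ≤ lam * ∑ i, ∑ j, η i j ^ 2 := by positivity
  simp only [Finset.sum_const, Finset.card_univ, Fintype.card_fin, nsmul_eq_mul]
  linarith

/-- For suitable weights, `lyap` decreases along the estimation subsystem at least at the rate
`residual`. -/
theorem exists_lyapDeriv_le {N : ℕ} (hN : 1 < N) {f : Fin N → (Fin N → ℝ) → ℝ}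
    (hf : SmoothLipschitz f) (hmono : StronglyMonotone f) {a : Matrix (Fin N) (Fin N) ℝ}
    {ystar : Fin N → ℝ} (hy : ∀ i, ownGrad f i ystar = 0) {r : Fin N → ℝ} (hr : ∀ i, 0 < r i)
    {lam C : ℝ} (hlam : 0 < lam)
    (hco : ∀ η : Fin N → Fin N → ℝ,
      lam * ∑ i, ∑ j, η i j ^ 2 ≤ ∑ i, ∑ j, r i * η i j * consOp a η i j)
    (hC : ∀ η : Fin N → Fin N → ℝ, ∑ i, ∑ j, η i j ^ 2 ≤ C * ∑ i, ∑ j, consOp a η i j ^ 2) :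
    ∃ K b : ℝ, 0 < K ∧ ∀ s, lyapDeriv f a r ystar K b s ≤ -residual a ystar s := by
  obtain ⟨ω, hω, hm⟩ := hmono
  obtain ⟨l, hl, hL⟩ := exists_ownGrad_sq_bound hf
  obtain ⟨A, B, hA, hB, hcons⟩ := consensus_estimate hlam hco
  have : Nonempty (Fin N) := ⟨⟨0, by omega⟩⟩
  obtain ⟨i₀, hi₀⟩ := Finite.exists_min r
  -- `K` is chosen to dominate the gradients, and then the reference gain `b` to dominate the rest
  set K := 2 * (1 + A * (2 * N * l)) / ω with hK
  have hK0 : 0 < K := by positivity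
  set b₀ := max 0 (1 + A * (2 * l) * C + B + K * (l / (2 * ω)) * C) with hb₀
  refine ⟨K, b₀ / r i₀, hK0, fun s => ?_⟩
  obtain ⟨z, c, w⟩ := s
  obtain ⟨hg1, hg2⟩ := ownGrad_estimates hω hL hm hy z w
  have hE : ∑ i, ∑ j, (z i j + w j) ^ 2 ≤ C * ∑ i, ∑ j, consErr a z w i j ^ 2 := by
    simpa only [consErr_eq_consOp] using hC fun i j => z i j + w j
  have h1 := hcons c (consErr a z w) fun j => ownGrad f j (z j)
  simp only [residual, lyapDeriv]
  set E := ∑ i, ∑ j, (z i j + w j) ^ 2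
  set X := ∑ i, ∑ j, consErr a z w i j ^ 2 with hX
  set W := ∑ j, (w j + ystar j) ^ 2
  set G := ∑ j, ownGrad f j (z j) ^ 2
  set P := ∑ j, (w j + ystar j) * ownGrad f j (z j)
  have hX0 : 0 ≤ X := by positivity
  -- the term `-b ∑ rᵢ ξ²` with `b = b₀ / min r` is at most `-b₀ ∑ ξ²`
  have h2 : b₀ * X ≤ ∑ i, ∑ j, r i * (b₀ / r i₀ * consErr a z w i j ^ 2) := by
    rw [hX, Finset.mul_sum]
    refine Finset.sum_le_sum fun i _ => ?_
    rw [Finset.mul_sum]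
    refine Finset.sum_le_sum fun j _ => ?_
    rw [← mul_assoc]
    refine mul_le_mul_of_nonneg_right ?_ (sq_nonneg _)
    rw [mul_div_assoc', le_div_iff₀ (hr i₀), mul_comm]
    exact mul_le_mul_of_nonneg_right (hi₀ i) (le_max_left _ _)
  simp only [mul_sub (r _), Finset.sum_sub_distrib]
  have h3 : A * G ≤ A * (2 * l * E + 2 * N * l * W) := mul_le_mul_of_nonneg_left hg1 hA
  have h4 : K * P ≤ K * (-(ω / 2) * W + l / (2 * ω) * E) := mul_le_mul_of_nonneg_left hg2 hK0.le
  have h5 : (A * (2 * l) + K * (l / (2 * ω))) * E ≤ (A * (2 * l) + K * (l / (2 * ω))) * (C * X) :=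
    mul_le_mul_of_nonneg_left hE (by positivity)
  have h6 : K * (ω / 2) = 1 + A * (2 * N * l) := by
    rw [hK]
    field_simp
  have h7 : (1 + A * (2 * l) * C + B + K * (l / (2 * ω)) * C) * X ≤ b₀ * X :=
    mul_le_mul_of_nonneg_right (le_max_right _ _) hX0
  have h8 : K * (ω / 2) * W = (1 + A * (2 * N * l)) * W := by rw [h6]
  simp only [mul_add (r _)] at h1 ⊢
  linarith

theorem abs_le_one_add_of_sq_le {x M : ℝ} (h : x ^ 2 ≤ M) : |x| ≤ 1 + M := by
  nlinarith [sq_abs x, sq_nonneg (|x| - 1), abs_nonneg x]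

section
variable {N : ℕ} {a : Matrix (Fin N) (Fin N) ℝ} {r ystar : Fin N → ℝ} {K b : ℝ}

theorem lyap_term_nonneg (hr : ∀ i, 0 < r i) {s : EstState N} (hs : ∀ i j, 0 ≤ s.2.1 i j)
    (i j : Fin N) :
    0 ≤ r i * (s.2.1 i j * consErr a s.1 s.2.2 i j ^ 2 + consErr a s.1 s.2.2 i j ^ 4 / 2
      + (s.2.1 i j - b) ^ 2 / 2) := by
  have := hr i
  have := hs i j
  positivity

theorem lyap_nonneg (hr : ∀ i, 0 < r i) (hK : 0 < K) {s : EstState N}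
    (hs : ∀ i j, 0 ≤ s.2.1 i j) : 0 ≤ lyap a r ystar K b s :=
  add_nonneg (Finset.sum_nonneg fun i _ => Finset.sum_nonneg fun j _ => lyap_term_nonneg hr hs i j)
    (by positivity)

/-- Sublevel sets of `lyap` are bounded, as long as the adaptive gains are nonnegative. -/
theorem exists_bound_of_lyap_le (hN : 1 < N) (hr : ∀ i, 0 < r i) (hK : 0 < K) {C : ℝ} (hC0 : 0 < C)
    (hC : ∀ η : Fin N → Fin N → ℝ, ∑ i, ∑ j, η i j ^ 2 ≤ C * ∑ i, ∑ j, consOp a η i j ^ 2)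
    (V : ℝ) :
    ∃ R : ℝ, ∀ s : EstState N, (∀ i j, 0 ≤ s.2.1 i j) → lyap a r ystar K b s ≤ V → ‖s‖ ≤ R := by
  have : Nonempty (Fin N) := ⟨⟨0, by omega⟩⟩
  obtain ⟨i₀, hi₀⟩ := Finite.exists_min r
  have hri₀ := hr i₀
  set Bc := |b| + (1 + 2 * V / r i₀)
  set Bw := ∑ j, |ystar j| + (1 + 2 * V / K)
  set Bx := C * (N * (N * (1 + 2 * V / r i₀)))
  set Bz := 1 + Bx + Bw
  refine ⟨max Bz (max Bc Bw), fun s hs hV => ?_⟩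
  obtain ⟨z, c, w⟩ := s
  have hterm := lyap_term_nonneg (a := a) (b := b) hr hs
  have hW0 : 0 ≤ K / 2 * ∑ j, (w j + ystar j) ^ 2 := by positivity
  have hV' : ∑ i, ∑ j, r i * (c i j * consErr a z w i j ^ 2 + consErr a z w i j ^ 4 / 2
      + (c i j - b) ^ 2 / 2) + K / 2 * ∑ j, (w j + ystar j) ^ 2 ≤ V := hV
  have hsum0 := Finset.sum_nonneg fun i (_ : i ∈ Finset.univ) =>
    Finset.sum_nonneg fun j (_ : j ∈ Finset.univ) => hterm i j
  simp only at hterm hsum0 hs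
  have hV0 : 0 ≤ V := by linarith
  have hij : ∀ i j,
      (consErr a z w i j ^ 2) ^ 2 ≤ 2 * V / r i₀ ∧ (c i j - b) ^ 2 ≤ 2 * V / r i₀ := by
    intro i j
    have h1 := (Finset.single_le_sum (fun j _ => hterm i j) (Finset.mem_univ j)).trans
      (Finset.single_le_sum (f := fun i => ∑ j, r i * (c i j * consErr a z w i j ^ 2
        + consErr a z w i j ^ 4 / 2 + (c i j - b) ^ 2 / 2))
        (fun i _ => Finset.sum_nonneg fun j _ => hterm i j) (Finset.mem_univ i))
    have h2 : r i₀ * (c i j * consErr a z w i j ^ 2 + consErr a z w i j ^ 4 / 2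
        + (c i j - b) ^ 2 / 2) ≤ V := by
      refine le_trans (mul_le_mul_of_nonneg_right (hi₀ i) ?_) (by linarith)
      have := hs i j
      positivity
    have h3 : 0 ≤ r i₀ * (c i j * consErr a z w i j ^ 2) :=
      mul_nonneg hri₀.le (mul_nonneg (hs i j) (sq_nonneg _))
    have h4 : 0 ≤ r i₀ * (consErr a z w i j ^ 4 / 2) := by positivity
    have h5 : 0 ≤ r i₀ * ((c i j - b) ^ 2 / 2) := by positivity
    constructor
    · rw [le_div_iff₀ hri₀]; linarith
    · rw [le_div_iff₀ hri₀]; linarith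
  have hc : ∀ i j, |c i j| ≤ Bc := by
    intro i j
    have h1 := abs_le_one_add_of_sq_le (hij i j).2
    have h2 := abs_add_le (c i j - b) b
    rw [sub_add_cancel] at h2
    linarith
  have hw : ∀ j, |w j| ≤ Bw := by
    intro j
    have h0 : (w j + ystar j) ^ 2 ≤ ∑ j, (w j + ystar j) ^ 2 :=
      Finset.single_le_sum (f := fun j => (w j + ystar j) ^ 2) (fun j _ => sq_nonneg _)
        (Finset.mem_univ j)
    have h1 : (w j + ystar j) ^ 2 ≤ 2 * V / K := by
      rw [le_div_iff₀ hK]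
      nlinarith
    have h2 := abs_le_one_add_of_sq_le h1
    have h3 := abs_sub (w j + ystar j) (ystar j)
    rw [add_sub_cancel_right] at h3
    have h4 : |ystar j| ≤ ∑ j, |ystar j| :=
      Finset.single_le_sum (f := fun j => |ystar j|) (fun j _ => abs_nonneg _) (Finset.mem_univ j)
    linarith
  have hz : ∀ i j, |z i j| ≤ Bz := by
    intro i j
    have h1 := hC fun i j => z i j + w j
    simp only [← consErr_eq_consOp] at h1
    have h2 : ∑ i, ∑ j, consErr a z w i j ^ 2 ≤ N * (N * (1 + 2 * V / r i₀)) := by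
      calc ∑ i, ∑ j, consErr a z w i j ^ 2
          ≤ ∑ _i : Fin N, ∑ _j : Fin N, (1 + 2 * V / r i₀) := by
            refine Finset.sum_le_sum fun i _ => Finset.sum_le_sum fun j _ => ?_
            have := abs_le_one_add_of_sq_le (hij i j).1
            rwa [abs_of_nonneg (sq_nonneg _)] at this
        _ = N * (N * (1 + 2 * V / r i₀)) := by
            simp only [Finset.sum_const, Finset.card_univ, Fintype.card_fin, nsmul_eq_mul]
    have h3 : (z i j + w j) ^ 2 ≤ ∑ i, ∑ j, (z i j + w j) ^ 2 :=
      (Finset.single_le_sum (f := fun j => (z i j + w j) ^ 2) (fun j _ => sq_nonneg _)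
        (Finset.mem_univ j)).trans
      (Finset.single_le_sum (f := fun i => ∑ j, (z i j + w j) ^ 2)
        (fun i _ => Finset.sum_nonneg fun j _ => sq_nonneg _) (Finset.mem_univ i))
    have h4 := abs_le_one_add_of_sq_le (h3.trans (h1.trans (mul_le_mul_of_nonneg_left h2 hC0.le)))
    have h5 := abs_sub (z i j + w j) (w j)
    rw [add_sub_cancel_right] at h5
    have h6 := hw j
    simp only [Bz, Bx]
    linarith
  have hc0 : 0 ≤ Bc := by positivity
  have hw0 : 0 ≤ Bw := by positivity
  have hz0 : 0 ≤ Bz := by positivity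
  rw [Prod.norm_def, Prod.norm_def]
  refine max_le_max ?_ (max_le_max ?_ ?_)
  · exact (pi_norm_le_iff_of_nonneg hz0).2 fun i => (pi_norm_le_iff_of_nonneg hz0).2 (hz i)
  · exact (pi_norm_le_iff_of_nonneg hc0).2 fun i => (pi_norm_le_iff_of_nonneg hc0).2 (hc i)
  · exact (pi_norm_le_iff_of_nonneg hw0).2 hw

end

/-! ### The change of coordinates of an integrator chain -/

section
variable {m : ℕ}

/-- Powers of a strictly upper triangular matrix push vectors towards the first coordinates. -/
theorem pow_mulVec_eq_zero {M : Matrix (Fin m) (Fin m) ℝ} (hM : ∀ p q, q ≤ p → M p q = 0)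
    (v : Fin m → ℝ) (k : ℕ) (p : Fin m) (hp : m ≤ p.val + k) : ((M ^ k) *ᵥ v) p = 0 := by
  induction k generalizing p with
  | zero => exact absurd p.isLt (by omega)
  | succ k ih =>
    rw [pow_succ', ← Matrix.mulVec_mulVec, Matrix.mulVec, dotProduct]
    refine Finset.sum_eq_zero fun q _ => ?_
    by_cases h : q ≤ p
    · rw [hM p q h, zero_mul]
    · rw [ih q (by have := Fin.lt_def.1 (not_le.1 h); omega), mul_zero]

theorem pow_succ_mulVec_antidiag {M : Matrix (Fin m) (Fin m) ℝ} (hM : ∀ p q, q ≤ p → M p q = 0)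
    (v : Fin m → ℝ) (k : ℕ) (p q : Fin m) (hpk : p.val + k + 2 = m) (hpq : p.val + 1 = q.val) :
    ((M ^ (k + 1)) *ᵥ v) p = M p q * ((M ^ k) *ᵥ v) q := by
  rw [pow_succ', ← Matrix.mulVec_mulVec, Matrix.mulVec, dotProduct]
  refine Finset.sum_eq_single q (fun r _ hr => ?_) (by simp)
  by_cases h : r ≤ p
  · rw [hM p r h, zero_mul]
  · have h1 := Fin.lt_def.1 (not_le.1 h)
    have h2 : r.val ≠ q.val := fun h => hr (Fin.ext h)
    rw [pow_mulVec_eq_zero hM v k r (by omega), mul_zero]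

theorem sysA_eq_zero (p q : Fin m) (h : q ≤ p) : sysA m p q = 0 := by
  have := Fin.le_def.1 h
  simp only [sysA, Matrix.of_apply]
  rw [if_neg (by omega)]

theorem barA_eq_zero (θ : ℝ) (p q : Fin m) (h : q ≤ p) : barA m θ p q = 0 := by
  have := Fin.le_def.1 h
  simp only [barA, Matrix.of_apply]
  rw [if_neg (by omega)]

theorem ctrb_sysA_antidiag (k : ℕ) (p : Fin m) (hp : p.val + k + 1 = m) :
    ((sysA m ^ k) *ᵥ sysB m) p = 1 := by
  induction k generalizing p with
  | zero => simp only [pow_zero, Matrix.one_mulVec, sysB]; rw [if_pos (by omega)]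
  | succ k ih =>
    rw [pow_succ_mulVec_antidiag sysA_eq_zero _ k p ⟨p.val + 1, by omega⟩ (by omega) rfl,
      ih _ (by simp only; omega)]
    simp [sysA]

theorem ctrb_barA_antidiag (θ : ℝ) (k : ℕ) (p : Fin m) (hp : p.val + k + 1 = m) :
    ((barA m θ ^ k) *ᵥ barB m) p = ∏ l ∈ Finset.Icc 1 k, θ ^ l := by
  induction k generalizing p with
  | zero => simp [barB]
  | succ k ih =>
    rw [pow_succ_mulVec_antidiag (barA_eq_zero θ) _ k p ⟨p.val + 1, by omega⟩ (by omega) rfl,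
      ih _ (by simp only; omega), Finset.prod_Icc_succ_top (by omega), mul_comm]
    congr 1
    simp only [barA, Matrix.of_apply]
    rw [if_pos (by omega)]
    congr 1
    omega

/-- A matrix that vanishes below its antidiagonal, with nonzero antidiagonal, is invertible. -/
theorem isUnit_det_of_antitriangular {U : Matrix (Fin m) (Fin m) ℝ}
    (h0 : ∀ p k : Fin m, m ≤ p.val + k.val → U p k = 0)
    (h1 : ∀ p k : Fin m, p.val + k.val + 1 = m → U p k ≠ 0) : IsUnit U.det := by
  have htri : (U.submatrix id Fin.revPerm).det = ∏ p, U p (Fin.rev p) := by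
    refine Matrix.det_of_isUpperTriangular fun p k hk => ?_
    have hk' := Fin.lt_def.1 (show k < p from hk)
    exact h0 _ _ (by simp only [id, Fin.revPerm_apply, Fin.val_rev]; omega)
  rw [Matrix.det_permute'] at htri
  have hne : ∏ p, U p (Fin.rev p) ≠ 0 := Finset.prod_ne_zero_iff.2 fun p _ =>
    h1 _ _ (by rw [Fin.val_rev]; omega)
  rw [isUnit_iff_ne_zero]
  intro h
  rw [h, mul_zero] at htri
  exact hne htri.symm

theorem isUnit_det_ctrb_sysA : IsUnit (ctrb (sysA m) (sysB m)).det := by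
  refine isUnit_det_of_antitriangular (fun p k h => ?_) (fun p k h => ?_)
  · exact pow_mulVec_eq_zero sysA_eq_zero _ _ _ h
  · rw [ctrb, Matrix.of_apply, ctrb_sysA_antidiag _ _ h]
    exact one_ne_zero

theorem isUnit_det_ctrb_barA {θ : ℝ} (hθ : 0 < θ) : IsUnit (ctrb (barA m θ) (barB m)).det := by
  refine isUnit_det_of_antitriangular (fun p k h => ?_) (fun p k h => ?_)
  · exact pow_mulVec_eq_zero (barA_eq_zero θ) _ _ _ h
  · rw [ctrb, Matrix.of_apply, ctrb_barA_antidiag _ _ _ h]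
    exact (Finset.prod_pos fun l _ => pow_pos hθ l).ne'

/-- For nilpotent `A` the controllability matrix intertwines `A` with the shift. -/
theorem mul_ctrb {A : Matrix (Fin m) (Fin m) ℝ} {B : Fin m → ℝ}
    (hA : (A ^ m) *ᵥ B = 0) : A * ctrb A B = ctrb A B * (sysA m)ᵀ := by
  ext p k
  have h1 : (A * ctrb A B) p k = ((A ^ (k.val + 1)) *ᵥ B) p := by
    rw [pow_succ', ← Matrix.mulVec_mulVec]
    rfl
  rw [h1, Matrix.mul_apply]
  simp only [Matrix.transpose_apply, sysA, Matrix.of_apply, mul_ite, mul_one, mul_zero]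
  by_cases hk : k.val + 1 < m
  · rw [Finset.sum_eq_single ⟨k.val + 1, hk⟩
      (fun q _ hq => if_neg fun h => hq (Fin.ext h.symm)) (by simp), if_pos rfl]
    rfl
  · rw [Finset.sum_eq_zero fun q _ => if_neg (by omega),
      show k.val + 1 = m by omega, hA, Pi.zero_apply]

theorem pow_mulVec_self_eq_zero {M : Matrix (Fin m) (Fin m) ℝ} (hM : ∀ p q, q ≤ p → M p q = 0)
    (v : Fin m → ℝ) : (M ^ m) *ᵥ v = 0 :=
  funext fun p => pow_mulVec_eq_zero hM v m p (by omega)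

theorem isUnit_det_transf {θ : ℝ} (hθ : 0 < θ) : IsUnit (transf m θ).det := by
  rw [transf, Matrix.det_mul]
  exact isUnit_det_ctrb_sysA.mul
    (Matrix.isUnit_nonsing_inv_det _ (isUnit_det_ctrb_barA hθ))

theorem transf_mul_ctrb {θ : ℝ} (hθ : 0 < θ) :
    transf m θ * ctrb (barA m θ) (barB m) = ctrb (sysA m) (sysB m) := by
  rw [transf, Matrix.mul_assoc, Matrix.nonsing_inv_mul _ (isUnit_det_ctrb_barA hθ), Matrix.mul_one]

theorem transf_mul_barA {θ : ℝ} (hθ : 0 < θ) : transf m θ * barA m θ = sysA m * transf m θ := by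
  have hU := isUnit_det_ctrb_barA (m := m) hθ
  have h1 : transf m θ * barA m θ * ctrb (barA m θ) (barB m) =
      sysA m * transf m θ * ctrb (barA m θ) (barB m) := by
    rw [Matrix.mul_assoc, mul_ctrb (pow_mulVec_self_eq_zero (barA_eq_zero θ) _),
      ← Matrix.mul_assoc, transf_mul_ctrb hθ, Matrix.mul_assoc, transf_mul_ctrb hθ,
      mul_ctrb (pow_mulVec_self_eq_zero sysA_eq_zero _)]
  have h2 := congrArg (fun M => M * (ctrb (barA m θ) (barB m))⁻¹) h1
  simpa only [Matrix.mul_assoc, Matrix.mul_nonsing_inv _ hU, Matrix.mul_one] using h2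

theorem mulVec_sysC (hm : 0 < m) (M : Matrix (Fin m) (Fin m) ℝ) :
    M *ᵥ sysC m = fun p => M p ⟨0, hm⟩ := by
  funext p
  rw [Matrix.mulVec, dotProduct, Finset.sum_eq_single ⟨0, hm⟩]
  · simp [sysC]
  · intro q _ hq
    simp only [sysC]
    rw [if_neg fun h => hq (Fin.ext h), mul_zero]
  · simp

theorem sysC_dotProduct (hm : 0 < m) (v : Fin m → ℝ) : sysC m ⬝ᵥ v = v ⟨0, hm⟩ := by
  rw [dotProduct, Finset.sum_eq_single ⟨0, hm⟩]
  · simp [sysC]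
  · intro q _ hq
    simp only [sysC]
    rw [if_neg fun h : q.val = 0 => hq (Fin.ext h), zero_mul]
  · simp

theorem mulVec_sysB (hm : 0 < m) (M : Matrix (Fin m) (Fin m) ℝ) :
    M *ᵥ sysB m = fun p => M p ⟨m - 1, by omega⟩ := by
  funext p
  rw [Matrix.mulVec, dotProduct, Finset.sum_eq_single ⟨m - 1, by omega⟩]
  · simp only [sysB]
    rw [if_pos (by omega), mul_one]
  · intro q _ hq
    simp only [sysB]
    rw [if_neg fun h => hq (Fin.ext (by simp only; omega)), mul_zero]
  · simp

theorem transf_mulVec_barB (hm : 0 < m) {θ : ℝ} (hθ : 0 < θ) :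
    transf m θ *ᵥ barB m = sysB m := by
  have h1 : ctrb (barA m θ) (barB m) *ᵥ sysC m = barB m := by
    rw [mulVec_sysC hm]; simp [ctrb]
  have h2 : ctrb (sysA m) (sysB m) *ᵥ sysC m = sysB m := by
    rw [mulVec_sysC hm]; simp [ctrb]
  rw [← h1, Matrix.mulVec_mulVec, transf_mul_ctrb hθ, h2]

/-- The first column of `T` is a multiple of the first unit vector. This is why a limit of `x̄`
along that vector makes the output converge and all other components of `x` vanish. -/
theorem transf_mulVec_sysC (hm : 0 < m) {θ : ℝ} (hθ : 0 < θ) :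
    transf m θ *ᵥ ((∏ k ∈ Finset.Icc 1 (m - 1), θ ^ k) • sysC m) = sysC m := by
  have h1 : ctrb (barA m θ) (barB m) *ᵥ sysB m =
      (∏ k ∈ Finset.Icc 1 (m - 1), θ ^ k) • sysC m := by
    rw [mulVec_sysB hm]
    funext p
    simp only [ctrb, Matrix.of_apply, Pi.smul_apply, sysC, smul_eq_mul]
    by_cases hp : p.val = 0
    · rw [ctrb_barA_antidiag _ _ _ (by omega), if_pos hp, mul_one]
    · rw [pow_mulVec_eq_zero (barA_eq_zero θ) _ _ _ (by omega), if_neg hp, mul_zero]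
  have h2 : ctrb (sysA m) (sysB m) *ᵥ sysB m = sysC m := by
    rw [mulVec_sysB hm]
    funext p
    simp only [ctrb, Matrix.of_apply, sysC]
    by_cases hp : p.val = 0
    · rw [ctrb_sysA_antidiag _ _ (by omega), if_pos hp]
    · rw [pow_mulVec_eq_zero sysA_eq_zero _ _ _ (by omega), if_neg hp]
  rw [← h1, Matrix.mulVec_mulVec, transf_mul_ctrb hθ, h2]

theorem transf_mulVec_barState {θ : ℝ} (hθ : 0 < θ) (x : Fin m → ℝ) :
    transf m θ *ᵥ barState m θ x = x := by
  rw [barState, Matrix.mulVec_mulVec, Matrix.mul_nonsing_inv _ (isUnit_det_transf hθ),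
    Matrix.one_mulVec]

/-- In the transformed coordinates the integrator chain has the system matrices `Ā`, `B̄`. -/
theorem barState_field (hm : 0 < m) {θ : ℝ} (hθ : 0 < θ) (x : Fin m → ℝ) (u : ℝ) :
    barState m θ (sysA m *ᵥ x + u • sysB m) = barA m θ *ᵥ barState m θ x + u • barB m := by
  have hT := isUnit_det_transf (m := m) hθ
  have h : sysA m *ᵥ x + u • sysB m =
      transf m θ *ᵥ (barA m θ *ᵥ barState m θ x + u • barB m) := by
    rw [Matrix.mulVec_add, Matrix.mulVec_smul, transf_mulVec_barB hm hθ, Matrix.mulVec_mulVec,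
      transf_mul_barA hθ, ← Matrix.mulVec_mulVec, transf_mulVec_barState hθ]
  rw [h, barState, Matrix.mulVec_mulVec, Matrix.nonsing_inv_mul _ hT, Matrix.one_mulVec]

end

/-! ### Nested saturation -/

theorem sat_eq {Δ : ℝ} (hΔ : 0 < Δ) (s : ℝ) : sat Δ s = max (-Δ) (min s Δ) := by
  unfold sat
  rcases lt_trichotomy s 0 with h | h | h
  · rw [Real.sign_of_neg h, abs_of_neg h, min_eq_left (by linarith : s ≤ Δ), neg_one_mul,
      ← max_neg_neg, neg_neg, max_comm]
  · subst h
    simp [hΔ.le]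
  · rw [Real.sign_of_pos h, abs_of_pos h, one_mul, max_eq_right]
    exact le_min (by linarith) (by linarith)

theorem sat_of_le {Δ s : ℝ} (hΔ : 0 < Δ) (h : |s| ≤ Δ) : sat Δ s = s := by
  rw [sat_eq hΔ, min_eq_left (abs_le.1 h).2, max_eq_right (abs_le.1 h).1]

theorem sat_of_ge {Δ s : ℝ} (hΔ : 0 < Δ) (h : Δ ≤ s) : sat Δ s = Δ := by
  rw [sat_eq hΔ, min_eq_right h, max_eq_right (by linarith)]

theorem sat_of_le_neg {Δ s : ℝ} (hΔ : 0 < Δ) (h : s ≤ -Δ) : sat Δ s = -Δ := by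
  rw [sat_eq hΔ, min_eq_left (by linarith), max_eq_left h]

theorem abs_sat_le {Δ : ℝ} (hΔ : 0 < Δ) (s : ℝ) : |sat Δ s| ≤ Δ := by
  rw [sat_eq hΔ, abs_le]
  exact ⟨le_max_left _ _, max_le (by linarith) (min_le_right _ _)⟩

theorem lipschitzWith_sat {Δ : ℝ} (hΔ : 0 < Δ) : LipschitzWith 1 (sat Δ) := by
  have h := (LipschitzWith.id.min_const Δ).const_max (-Δ)
  have h2 : sat Δ = fun s : ℝ => max (-Δ) (min (id s) Δ) := funext fun s => sat_eq hΔ s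
  rw [h2]
  exact h

/-- Convergence of a chain of saturated scalar equations with geometrically separated gains `b`.
Working downwards from the last coordinate, each coordinate leaves saturation in finite time, since
its own gain beats the total of the smaller ones; afterwards the chain is linear and triangular. -/
theorem saturated_chain_tendsto {m : ℕ} {Δ : ℝ} (hΔ : 0 < Δ) {b : Fin m → ℝ}
    (hb0 : ∀ p, 0 < b p) (hb : ∀ p, ∑ q with q < p, b q < b p) {y : Fin m → ℝ → ℝ}
    {d : Fin m → ℝ → ℝ} (hd : ∀ p, Tendsto (d p) atTop (𝓝 0))
    (hy : ∀ p t, 0 ≤ t → HasDerivWithinAt (y p)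
      (-b p * sat Δ (y p t) + ∑ q with p < q, b q * (y q t - sat Δ (y q t))
        - ∑ q with q < p, b q * sat Δ (y q t) + d p t) (Ici 0) t) (p : Fin m) :
    Tendsto (y p) atTop (𝓝 0) := by
  have hcont : ∀ p, ContinuousOn (y p) (Ici 0) := fun p t ht => (hy p t ht).continuousWithinAt
  have hunsat : ∀ p, ∀ᶠ t in atTop, |y p t| ≤ Δ := by
    intro p
    induction p using WellFoundedGT.induction with
    | ind p ih =>
    have hall : ∀ᶠ t in atTop, ∀ q, p < q → |y q t| ≤ Δ :=
      eventually_all.2 fun q => by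
        by_cases h : p < q
        · exact (ih q h).mono fun t ht _ => ht
        · exact Eventually.of_forall fun t ht => absurd ht h
    set ε := Δ * (b p - ∑ q with q < p, b q) / 2 with hε
    have hε0 : 0 < ε := by
      have := hb p
      have : 0 < b p - ∑ q with q < p, b q := by linarith
      positivity
    have hdp : ∀ᶠ t in atTop, |d p t| < ε := by
      have h0 : Tendsto (fun t => |d p t|) atTop (𝓝 0) := by simpa using (hd p).abs
      exact h0.eventually (gt_mem_nhds hε0)
    obtain ⟨T, hT⟩ := eventually_atTop.1 (hall.and (hdp.and (eventually_ge_atTop 0)))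
    have hlow : ∀ t, |∑ q with q < p, b q * sat Δ (y q t)| ≤ (∑ q with q < p, b q) * Δ := by
      intro t
      rw [Finset.sum_mul]
      refine (Finset.abs_sum_le_sum_abs _ _).trans (Finset.sum_le_sum fun q _ => ?_)
      rw [abs_mul, abs_of_pos (hb0 q)]
      exact mul_le_mul_of_nonneg_left (abs_sat_le hΔ _) (hb0 q).le
    have hhigh : ∀ t, T ≤ t → ∑ q with p < q, b q * (y q t - sat Δ (y q t)) = 0 := by
      intro t ht
      refine Finset.sum_eq_zero fun q hq => ?_
      rw [sat_of_le hΔ ((hT t ht).1 q (Finset.mem_filter.1 hq).2), sub_self, mul_zero]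
    refine eventually_abs_le_of_deriv (T₀ := T) hε0
      (fun t ht => (hy p t (hT t ht).2.2).mono (Ici_subset_Ici.2 (hT t ht).2.2))
      ((hcont p).mono fun t ht => (hT t ht).2.2) (fun t ht h => ?_) (fun t ht h => ?_)
    · rw [hhigh t ht, sat_of_ge hΔ h]
      have h1 := abs_le.1 (hlow t)
      have h2 := abs_lt.1 (hT t ht).2.1
      linarith
    · rw [hhigh t ht, sat_of_le_neg hΔ h]
      have h1 := abs_le.1 (hlow t)
      have h2 := abs_lt.1 (hT t ht).2.1
      linarith
  obtain ⟨T, hT⟩ := eventually_atTop.1 ((eventually_all.2 hunsat).and (eventually_ge_atTop 0))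
  induction p using WellFoundedLT.induction with
  | ind p ih =>
  have hlow : Tendsto (fun t => -(∑ q with q < p, b q * sat Δ (y q t)) + d p t) atTop (𝓝 0) := by
    have h1 : Tendsto (fun t => ∑ q with q < p, b q * sat Δ (y q t)) atTop
        (𝓝 (∑ q with q < p, b q * 0)) := by
      refine tendsto_finsetSum _ fun q hq => Tendsto.const_mul _ ?_
      have h2 := ((lipschitzWith_sat hΔ).continuous.tendsto 0).comp
        (ih q (Finset.mem_filter.1 hq).2)
      rwa [sat_of_le hΔ (by simpa using hΔ.le)] at h2
    simpa using h1.neg.add (hd p)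
  refine tendsto_zero_of_linear_decay (T₀ := T) (hb0 p) (fun t ht => ?_)
    ((hcont p).mono fun t ht => (hT t ht).2) hlow
  refine ((hy p t (hT t ht).2).mono (Ici_subset_Ici.2 (hT t ht).2)).congr_deriv ?_
  rw [Finset.sum_eq_zero (s := Finset.univ.filter fun q => p < q) fun q _ => by
    rw [sat_of_le hΔ ((hT t ht).1 q), sub_self, mul_zero], sat_of_le hΔ ((hT t ht).1 p)]
  ring

/-- For `θ < 1 / 2` each power of `θ` exceeds the sum of all the higher ones that occur. -/
theorem sum_pow_lt {m : ℕ} {θ : ℝ} (hθ : 0 < θ) (hθ' : θ < 1 / 2) (p : Fin m) :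
    ∑ q : Fin m with q < p, θ ^ (m - q.val) < θ ^ (m - p.val) := by
  have key : ∀ n, n ≤ m → ∑ q ∈ Finset.range n, θ ^ (m - q) < θ ^ (m - n) := by
    intro n
    induction n with
    | zero => intro _; simpa using pow_pos hθ m
    | succ n ih =>
      intro hn
      rw [Finset.sum_range_succ]
      have h1 := ih (by omega)
      have h2 : θ ^ (m - n) = θ ^ (m - (n + 1)) * θ := by
        rw [← pow_succ]
        congr 1
        omega
      have h3 : 0 < θ ^ (m - (n + 1)) := pow_pos hθ _
      nlinarith
  have h := key p.val p.isLt.le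
  have h2 : ∑ q : Fin m with q < p, θ ^ (m - q.val) =
      ∑ q ∈ Finset.range p.val, θ ^ (m - q) := by
    refine Finset.sum_bij (fun q _ => q.val) (fun q hq => ?_) (fun q _ r _ h => Fin.ext h)
      (fun n hn => ?_) (fun _ _ => rfl)
    · simpa using (Finset.mem_filter.1 hq).2
    · have hn' := Finset.mem_range.1 hn
      exact ⟨⟨n, hn'.trans p.isLt⟩, Finset.mem_filter.2 ⟨Finset.mem_univ _, Fin.lt_def.2 hn'⟩, rfl⟩
  rw [h2]
  exact h

/-- The control law as a sum over all coordinates, once the integral term is merged into the first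
transformed coordinate. -/
theorem control_eq {m : ℕ} (hm : 0 < m) (θ Δ : ℝ) (x : Fin m → ℝ) (w : ℝ) :
    control m θ Δ x w = -∑ q : Fin m, θ ^ (m - q.val) * sat Δ (barState m θ x q
      + sysC m q * ((∏ k ∈ Finset.Icc 1 (m - 1), θ ^ k) * w)) := by
  obtain ⟨n, rfl⟩ : ∃ n, m = n + 1 := ⟨m - 1, by omega⟩
  have h0 : sysC (n + 1) ⬝ᵥ barState (n + 1) θ x = barState (n + 1) θ x 0 :=
    sysC_dotProduct hm _
  have hsum : ∑ k : Fin (n + 1 - 1), θ ^ (k.val + 1) *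
        sat Δ (barState (n + 1) θ x ⟨n + 1 - (k.val + 1), by omega⟩) =
      ∑ q : Fin n, θ ^ (n + 1 - q.succ.val) * sat Δ (barState (n + 1) θ x q.succ
        + sysC (n + 1) q.succ * ((∏ k ∈ Finset.Icc 1 (n + 1 - 1), θ ^ k) * w)) := by
    refine Fintype.sum_equiv Fin.revPerm _ _ fun k => ?_
    have hk : (⟨n + 1 - (k.val + 1), by omega⟩ : Fin (n + 1)) = (Fin.rev k : Fin n).succ := by
      refine Fin.ext ?_
      have := k.isLt
      simp only [Fin.val_succ, Fin.val_rev]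
      omega
    have hpow : n + 1 - (Fin.rev k : Fin n).succ.val = k.val + 1 := by
      have := k.isLt
      simp only [Fin.val_succ, Fin.val_rev]
      omega
    have hC : sysC (n + 1) (Fin.rev k : Fin n).succ = 0 := by simp [sysC]
    rw [hk, Fin.revPerm_apply]
    exact (by rw [hpow, hC, zero_mul, add_zero])
  have hC0 : sysC (n + 1) 0 = 1 := by simp [sysC]
  rw [control, h0, hsum, Fin.sum_univ_succ, hC0, Fin.val_zero, one_mul, Nat.sub_zero]
  ring

/-- A player whose gradient integral converges to `-L`, with vanishing rate, is steered to the
state `(L, 0, …, 0)`. -/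
theorem player_tendsto {m : ℕ} (hm : 0 < m) {θ Δ : ℝ} (hθ : 0 < θ) (hθ' : θ < 1 / 2)
    (hΔ : 0 < Δ) {x : ℝ → Fin m → ℝ} {w g : ℝ → ℝ} {L : ℝ}
    (hx : ∀ t, 0 ≤ t → HasDerivWithinAt x
      (sysA m *ᵥ x t + control m θ Δ (x t) (w t) • sysB m) (Ici 0) t)
    (hw : ∀ t, 0 ≤ t → HasDerivWithinAt w (g t) (Ici 0) t) (hg : Tendsto g atTop (𝓝 0))
    (hwL : Tendsto w atTop (𝓝 (-L))) : Tendsto x atTop (𝓝 (L • sysC m)) := by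
  set P := ∏ k ∈ Finset.Icc 1 (m - 1), θ ^ k with hP
  set X : ℝ → Fin m → ℝ := fun t => barState m θ (x t) with hX
  have hXd : ∀ t, 0 ≤ t → HasDerivWithinAt X
      (barA m θ *ᵥ X t + control m θ Δ (x t) (w t) • barB m) (Ici 0) t := by
    intro t ht
    rw [← barState_field hm hθ]
    have h := (Matrix.mulVecLin (transf m θ)⁻¹).toContinuousLinearMap.hasFDerivAt
      (x := x t) |>.comp_hasDerivWithinAt t (hx t ht)
    exact h
  have hY : ∀ p, Tendsto (fun t => X t p + sysC m p * (P * w t)) atTop (𝓝 0) := by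
    refine saturated_chain_tendsto hΔ (b := fun q => θ ^ (m - q.val)) (fun q => pow_pos hθ _)
      (sum_pow_lt hθ hθ') (d := fun p t => sysC m p * (P * g t)) (fun p => ?_) (fun p t ht => ?_)
    · simpa using (hg.const_mul P).const_mul (sysC m p)
    · refine ((hasDerivWithinAt_pi.1 (hXd t ht) p).fun_add
        (((hw t ht).const_mul P).const_mul (sysC m p))).congr_deriv ?_
      rw [control_eq hm]
      simp only [Pi.add_apply, Pi.smul_apply, barB, smul_eq_mul, mul_one]
      set Y : Fin m → ℝ := fun q => X t q + sysC m q * (P * w t) with hYdef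
      have h1 : (barA m θ *ᵥ X t) p = ∑ q with p < q, θ ^ (m - q.val) * Y q := by
        rw [Matrix.mulVec, dotProduct, Finset.sum_filter]
        refine Finset.sum_congr rfl fun q _ => ?_
        simp only [barA, Matrix.of_apply, ← Fin.lt_def]
        by_cases h : p < q
        · have : q.val ≠ 0 := by have := Fin.lt_def.1 h; omega
          rw [if_pos h, if_pos h]
          simp [hYdef, sysC, this]
        · rw [if_neg h, if_neg h, zero_mul]
      have h2 : ∑ q, θ ^ (m - q.val) * sat Δ (Y q) =
          θ ^ (m - p.val) * sat Δ (Y p) + ∑ q with p < q, θ ^ (m - q.val) * sat Δ (Y q)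
            + ∑ q with q < p, θ ^ (m - q.val) * sat Δ (Y q) := by
        rw [← Finset.sum_filter_add_sum_filter_not Finset.univ (fun q => q < p), add_comm]
        congr 1
        have h3 : Finset.univ.filter (fun q => ¬ q < p) =
            insert p (Finset.univ.filter fun q => p < q) := by
          ext q
          simp [le_iff_eq_or_lt, eq_comm]
        rw [h3, Finset.sum_insert (by simp)]
      change (barA m θ *ᵥ X t) p + -∑ q, θ ^ (m - q.val) * sat Δ (Y q) + sysC m p * (P * g t) =
        -θ ^ (m - p.val) * sat Δ (Y p) + ∑ q with p < q, θ ^ (m - q.val) * (Y q - sat Δ (Y q))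
          - ∑ q with q < p, θ ^ (m - q.val) * sat Δ (Y q) + sysC m p * (P * g t)
      rw [h1, h2]
      simp only [mul_sub, Finset.sum_sub_distrib]
      ring
  have hXlim : Tendsto X atTop (𝓝 (L • P • sysC m)) := by
    refine tendsto_pi_nhds.2 fun p => ?_
    have h := (hY p).sub ((hwL.const_mul P).const_mul (sysC m p))
    refine (h.congr fun t => by ring).trans (le_of_eq ?_)
    congr 1
    simp only [Pi.smul_apply, smul_eq_mul]
    ring
  have hlim := ((Matrix.mulVecLin (transf m θ)).toContinuousLinearMap.continuous.tendsto _).comp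
    hXlim
  have h3 : (Matrix.mulVecLin (transf m θ)).toContinuousLinearMap (L • P • sysC m) =
      L • sysC m := by
    rw [map_smul]
    congr 1
    exact transf_mulVec_sysC hm hθ
  rw [h3] at hlim
  refine hlim.congr fun t => ?_
  exact transf_mulVec_barState hθ (x t)

/-! ### Closed-loop trajectories -/

section
variable {N : ℕ} {f : Fin N → (Fin N → ℝ) → ℝ} {a : Matrix (Fin N) (Fin N) ℝ}

/-- Along the (possibly rescaled) estimation subsystem the adaptive gains stay nonnegative and the
Lyapunov function does not increase. -/
theorem estField_invariant {r ystar : Fin N → ℝ} {K b : ℝ}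
    (hD : ∀ s, lyapDeriv f a r ystar K b s ≤ -residual a ystar s) {S : Set ℝ} (hS : Convex ℝ S)
    (hS0 : S ⊆ Ici 0) (h0 : (0 : ℝ) ∈ S) {k : ℝ → ℝ} (hk : ∀ t, 0 ≤ k t) {γ : ℝ → EstState N}
    (hγ : ∀ t ∈ S, HasDerivWithinAt γ (k t • estField f a (γ t)) S t)
    (hc : ∀ i j, 0 < (γ 0).2.1 i j) :
    (∀ i j, MonotoneOn (fun t => (γ t).2.1 i j) S) ∧ (∀ t ∈ S, ∀ i j, 0 ≤ (γ t).2.1 i j) ∧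
      ∀ t ∈ S, lyap a r ystar K b (γ t) ≤ lyap a r ystar K b (γ 0) := by
  have hmono : ∀ i j, MonotoneOn (fun t => (γ t).2.1 i j) S := by
    intro i j
    have hd : ∀ t ∈ S, HasDerivWithinAt (fun t => (γ t).2.1 i j)
        (k t * consErr a (γ t).1 (γ t).2.2 i j ^ 2) S t := fun t ht =>
      hasDerivWithinAt_pi.1 (hasDerivWithinAt_pi.1 (hγ t ht).snd.fst i) j
    exact monotoneOn_of_hasDerivWithinAt_nonneg hS (fun t ht => (hd t ht).continuousWithinAt)
      (fun t ht => (hd t (interior_subset ht)).mono interior_subset)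
      (fun t _ => mul_nonneg (hk t) (sq_nonneg _))
  refine ⟨hmono, fun t ht i j => (hc i j).le.trans (hmono i j h0 ht (hS0 ht)), fun t ht => ?_⟩
  have hd : ∀ t ∈ S, HasDerivWithinAt (fun t => lyap a r ystar K b (γ t))
      (k t * lyapDeriv f a r ystar K b (γ t)) S t := fun t ht =>
    hasDerivWithinAt_lyap f a r ystar K b (hγ t ht)
  refine antitoneOn_of_hasDerivWithinAt_nonpos hS (fun t ht => (hd t ht).continuousWithinAt)
      (fun t ht => (hd t (interior_subset ht)).mono interior_subset)
      (fun t _ => mul_nonpos_of_nonneg_of_nonpos (hk t) ?_) h0 ht (hS0 ht)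
  linarith [hD (γ t), residual_nonneg a ystar (γ t)]

/-- Weights `r`, `K`, `b` for which `lyap` decreases at the rate `residual` and has bounded
sublevel sets; `C` bounds the estimation errors by the consensus errors. -/
theorem exists_lyapunov (hN : 1 < N) (hf : SmoothLipschitz f) (hmono : StronglyMonotone f)
    (ha : IsAdjacency a) (hconn : StronglyConnected a) {ystar : Fin N → ℝ}
    (hy : ∀ i, ownGrad f i ystar = 0) :
    ∃ (r : Fin N → ℝ) (K b C : ℝ), (∀ i, 0 < r i) ∧ 0 < K ∧ 0 < C ∧
      (∀ η : Fin N → Fin N → ℝ, ∑ i, ∑ j, η i j ^ 2 ≤ C * ∑ i, ∑ j, consOp a η i j ^ 2) ∧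
      (∀ s, lyapDeriv f a r ystar K b s ≤ -residual a ystar s) ∧
      ∀ V : ℝ, ∃ R : ℝ, ∀ s : EstState N, (∀ i j, 0 ≤ s.2.1 i j) →
        lyap a r ystar K b s ≤ V → ‖s‖ ≤ R := by
  obtain ⟨r, hr0, hr⟩ := exists_pos_left_null hN ha hconn
  obtain ⟨lam, hlam, hco⟩ := exists_consOp_coercive hN ha hconn hr0 hr
  obtain ⟨C, hC0, hC⟩ := exists_sum_sq_le_consOp hlam hco
  obtain ⟨K, b, hK, hD⟩ := exists_lyapDeriv_le hN hf hmono hy hr0 hlam hco hC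
  exact ⟨r, K, b, C, hr0, hK, hC0, hC, hD, exists_bound_of_lyap_le hN hr0 hK hC0 hC⟩

theorem locallyLipschitz_ownGrad (hf : SmoothLipschitz f) (i : Fin N) :
    LocallyLipschitz (ownGrad f i) := by
  obtain ⟨l, hl, hL⟩ := hf.2 i
  have h1 : LipschitzWith l.toNNReal fun v : EuclideanSpace ℝ (Fin N) =>
      ownGrad f i (WithLp.ofLp v) := by
    refine LipschitzWith.of_dist_le_mul fun y z => ?_
    rw [Real.coe_toNNReal _ hl.le, dist_eq_norm, dist_eq_norm]
    exact hL y z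
  exact h1.locallyLipschitz.comp
    (EuclideanSpace.equiv (Fin N) ℝ).symm.toContinuousLinearMap.lipschitz.locallyLipschitz

theorem locallyLipschitz_pi {α ι : Type*} [PseudoEMetricSpace α] [Fintype ι] {β : ι → Type*}
    [∀ i, PseudoEMetricSpace (β i)] {g : α → ∀ i, β i}
    (hg : ∀ i, LocallyLipschitz fun x => g x i) : LocallyLipschitz g := by
  intro x
  choose K t ht hK using fun i => hg i x
  refine ⟨∑ i, K i, ⋂ i, t i, Filter.iInter_mem.2 ht, fun y hy z hz => ?_⟩
  refine edist_pi_le_iff.2 fun i => ?_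
  refine (hK i (mem_iInter.1 hy i) (mem_iInter.1 hz i)).trans ?_
  gcongr
  exact Finset.single_le_sum (f := K) (fun _ _ => zero_le) (Finset.mem_univ i)

theorem continuous_estField (hf : SmoothLipschitz f) : Continuous (estField f a) := by
  have := fun i => (locallyLipschitz_ownGrad hf i).continuous
  unfold estField consErr
  fun_prop

/-- States of the closed loop: the players' states together with the estimation subsystem. -/
abbrev LoopState {N : ℕ} (m : Fin N → ℕ) : Type :=
  ((i : Fin N) → Fin (m i) → ℝ) × EstState N

/-- The vector field of the whole closed loop, with the gradient integrals as state variables. -/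
noncomputable def loopField (f : Fin N → (Fin N → ℝ) → ℝ) (a : Matrix (Fin N) (Fin N) ℝ)
    (m : Fin N → ℕ) (θ Δ : Fin N → ℝ) (s : LoopState m) : LoopState m :=
  (fun i => sysA (m i) *ᵥ s.1 i + control (m i) (θ i) (Δ i) (s.1 i) (s.2.2.2 i) • sysB (m i),
    estField f a s.2)

/-- The field is a polynomial map applied to the state, the saturated quantities and the partial
gradients; the latter two are Lipschitz. -/
theorem locallyLipschitz_loopField {m : Fin N → ℕ} (hm : ∀ i, 0 < m i) {θ Δ : Fin N → ℝ}
    (hΔ : ∀ i, 0 < Δ i) (hf : SmoothLipschitz f) : LocallyLipschitz (loopField f a m θ Δ) := by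
  let H : LoopState m → ((i : Fin N) → Fin (m i) → ℝ) × (Fin N → ℝ) := fun s =>
    (fun i q => sat (Δ i) (barState (m i) (θ i) (s.1 i) q
      + sysC (m i) q * ((∏ k ∈ Finset.Icc 1 (m i - 1), θ i ^ k) * s.2.2.2 i)),
      fun j => ownGrad f j (s.2.1 j))
  let P : LoopState m × (((i : Fin N) → Fin (m i) → ℝ) × (Fin N → ℝ)) → LoopState m := fun p =>
    (fun i => sysA (m i) *ᵥ p.1.1 i
        + (-∑ q : Fin (m i), θ i ^ (m i - q.val) * p.2.1 i q) • sysB (m i),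
      fun i j => -(p.1.2.2.1 i j + consErr a p.1.2.1 p.1.2.2.2 i j ^ 2)
        * consErr a p.1.2.1 p.1.2.2.2 i j,
      fun i j => consErr a p.1.2.1 p.1.2.2.2 i j ^ 2,
      fun j => p.2.2 j)
  have hFP : loopField f a m θ Δ = P ∘ fun s => (s, H s) := by
    funext s
    simp only [loopField, estField, P, H, Function.comp, control_eq (hm _)]
  have hP : ContDiff ℝ 1 P := by
    have hcons : ∀ i j, ContDiff ℝ 1 fun p :
        LoopState m × (((i : Fin N) → Fin (m i) → ℝ) × (Fin N → ℝ)) =>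
        consErr a p.1.2.1 p.1.2.2.2 i j := by
      intro i j
      unfold consErr
      fun_prop
    refine ContDiff.prodMk (contDiff_pi.2 fun i => contDiff_pi.2 fun p => ?_)
      (ContDiff.prodMk (contDiff_pi.2 fun i => contDiff_pi.2 fun j => ?_)
        (ContDiff.prodMk (contDiff_pi.2 fun i => contDiff_pi.2 fun j => ?_) ?_))
    · have h1 : ∀ q, ContDiff ℝ 1 fun p :
          LoopState m × (((i : Fin N) → Fin (m i) → ℝ) × (Fin N → ℝ)) => p.1.1 i q := fun q =>
        contDiff_pi.1 (contDiff_pi.1 (contDiff_fst.comp contDiff_fst) i) q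
      have h2 : ∀ q, ContDiff ℝ 1 fun p :
          LoopState m × (((i : Fin N) → Fin (m i) → ℝ) × (Fin N → ℝ)) => p.2.1 i q := fun q =>
        contDiff_pi.1 (contDiff_pi.1 (contDiff_fst.comp contDiff_snd) i) q
      simp only [Pi.add_apply, Pi.smul_apply, Matrix.mulVec, dotProduct, smul_eq_mul]
      exact (ContDiff.sum fun q _ => contDiff_const.mul (h1 q)).add
        ((ContDiff.sum fun q _ => contDiff_const.mul (h2 q)).neg.mul contDiff_const)
    · fun_prop
    · fun_prop
    · fun_prop
  have hH : LocallyLipschitz H := by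
    refine LocallyLipschitz.prodMk (locallyLipschitz_pi fun i => locallyLipschitz_pi fun q => ?_)
      (locallyLipschitz_pi fun j => ?_)
    · refine (lipschitzWith_sat (hΔ i)).locallyLipschitz.comp
        (g := fun s : LoopState m => barState (m i) (θ i) (s.1 i) q
          + sysC (m i) q * ((∏ k ∈ Finset.Icc 1 (m i - 1), θ i ^ k) * s.2.2.2 i)) ?_
      refine ContDiff.locallyLipschitz (𝕂 := ℝ) ?_
      have h1 : ∀ p, ContDiff ℝ 1 fun s : LoopState m => s.1 i p := fun p =>
        contDiff_pi.1 (contDiff_pi.1 contDiff_fst i) p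
      have h2 : ContDiff ℝ 1 fun s : LoopState m => s.2.2.2 i := by fun_prop
      simp only [barState, Matrix.mulVec, dotProduct]
      exact (ContDiff.sum fun p _ => contDiff_const.mul (h1 p)).add
        (contDiff_const.mul (contDiff_const.mul h2))
    · refine (locallyLipschitz_ownGrad hf j).comp (g := fun s : LoopState m => s.2.1 j) ?_
      exact ContDiff.locallyLipschitz (𝕂 := ℝ) (by fun_prop)
  rw [hFP]
  exact hP.locallyLipschitz.comp (LocallyLipschitz.id.prodMk hH)

/-- The integrator chain grows at most linearly in its state, since the control is bounded. -/
theorem exists_norm_chain_le {m : ℕ} (hm : 0 < m) (θ : ℝ) {Δ : ℝ} (hΔ : 0 < Δ) :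
    ∃ M ε : ℝ, 0 ≤ M ∧ 0 ≤ ε ∧ ∀ (x : Fin m → ℝ) (w : ℝ),
      ‖sysA m *ᵥ x + control m θ Δ x w • sysB m‖ ≤ M * ‖x‖ + ε := by
  refine ⟨‖(Matrix.mulVecLin (sysA m)).toContinuousLinearMap‖,
    (∑ q : Fin m, |θ ^ (m - q.val)| * Δ) * ‖sysB m‖, norm_nonneg _, by positivity,
    fun x w => (norm_add_le _ _).trans (add_le_add ?_ ?_)⟩
  · exact (Matrix.mulVecLin (sysA m)).toContinuousLinearMap.le_opNorm x
  · rw [norm_smul, Real.norm_eq_abs, control_eq hm, abs_neg]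
    refine mul_le_mul_of_nonneg_right ?_ (norm_nonneg _)
    refine (Finset.abs_sum_le_sum_abs _ _).trans (Finset.sum_le_sum fun q _ => ?_)
    rw [abs_mul]
    exact mul_le_mul_of_nonneg_left (abs_sat_le hΔ _) (abs_nonneg _)

/-- The a priori bound on `[0, T]` for all rescalings of the closed loop. The estimation subsystem
stays in a sublevel set of the Lyapunov function, and the chains obey Grönwall's inequality. -/
theorem exists_loop_bound (hN : 1 < N) {m : Fin N → ℕ} (hm : ∀ i, 0 < m i) {θ Δ : Fin N → ℝ}
    (hΔ : ∀ i, 0 < Δ i) (hf : SmoothLipschitz f) (hmono : StronglyMonotone f)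
    (ha : IsAdjacency a) (hconn : StronglyConnected a)
    (s₀ : LoopState m) (hs₀ : ∀ i j, 0 < s₀.2.2.1 i j)
    {T : ℝ} :
    ∃ R : ℝ, ∀ (k : ℝ → ℝ) (γ : ℝ → LoopState m),
      (∀ t, 0 ≤ k t ∧ k t ≤ 1) → γ 0 = s₀ →
      (∀ t ∈ Icc 0 T, HasDerivWithinAt γ (k t • loopField f a m θ Δ (γ t)) (Icc 0 T) t) →
      ∀ t ∈ Icc 0 T, ‖γ t‖ ≤ R := by
  obtain ⟨ystar, hy⟩ := exists_ownGrad_eq_zero hf hmono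
  obtain ⟨r, K, b, C, -, -, -, -, hD, hR⟩ := exists_lyapunov hN hf hmono ha hconn hy
  obtain ⟨R, hR⟩ := hR (lyap a r ystar K b s₀.2)
  choose M ε hM hε hMε using fun i => exists_norm_chain_le (hm i) (θ i) (hΔ i)
  refine ⟨max (∑ i, |gronwallBound ‖s₀.1 i‖ (M i) (ε i) T|) R, fun k γ hk h0 hγ t ht => ?_⟩
  have hT : 0 ≤ T := ht.1.trans ht.2
  rw [Prod.norm_def]
  refine max_le_max ?_ ?_
  · refine (pi_norm_le_iff_of_nonneg (Finset.sum_nonneg fun i _ => abs_nonneg _)).2 fun i => ?_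
    have hx : ∀ t ∈ Icc 0 T, HasDerivWithinAt (fun t => (γ t).1 i)
        (k t • (sysA (m i) *ᵥ (γ t).1 i
          + control (m i) (θ i) (Δ i) ((γ t).1 i) ((γ t).2.2.2 i) • sysB (m i))) (Icc 0 T) t :=
      fun t ht => hasDerivWithinAt_pi.1 (hγ t ht).fst i
    have hg := norm_le_gronwallBound_of_norm_deriv_right_le (δ := ‖s₀.1 i‖) (K := M i) (ε := ε i)
      (fun t ht => (hx t ht).continuousWithinAt)
      (fun t ht => (hx t ⟨ht.1, ht.2.le⟩).mono_of_mem_nhdsWithin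
        (mem_of_superset (Icc_mem_nhdsGE ht.2) (Icc_subset_Icc_left ht.1)))
      (by rw [h0]) (fun t ht => by
        rw [norm_smul, Real.norm_eq_abs, abs_of_nonneg (hk t).1]
        exact (mul_le_of_le_one_left (norm_nonneg _) (hk t).2).trans (hMε i _ _)) t ht
    refine hg.trans ((gronwallBound_mono (norm_nonneg _) (hε i) (hM i) (?_ : t - 0 ≤ T)).trans
      ((le_abs_self _).trans ?_))
    · linarith [ht.2]
    · exact Finset.single_le_sum (f := fun i => |gronwallBound ‖s₀.1 i‖ (M i) (ε i) T|)
        (fun i _ => abs_nonneg _) (Finset.mem_univ i)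
  · obtain ⟨-, hc, hV⟩ := estField_invariant hD (convex_Icc 0 T) Icc_subset_Ici_self
      (left_mem_Icc.2 hT) (fun t => (hk t).1) (fun t ht => (hγ t ht).snd) (by rw [h0]; exact hs₀)
    refine hR _ (hc t ht) ?_
    rw [← h0]
    exact hV t ht

theorem exists_trajectory (hN : 1 < N) {m : Fin N → ℕ} (hm : ∀ i, 0 < m i) {θ Δ : Fin N → ℝ}
    (hΔ : ∀ i, 0 < Δ i) (hf : SmoothLipschitz f) (hmono : StronglyMonotone f)
    (ha : IsAdjacency a) (hconn : StronglyConnected a)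
    (x₀ : (i : Fin N) → Fin (m i) → ℝ) (z₀ c₀ : Fin N → Fin N → ℝ) (hc₀ : ∀ i j, 0 < c₀ i j) :
    ∃ (x : ℝ → (i : Fin N) → Fin (m i) → ℝ) (z c : ℝ → Fin N → Fin N → ℝ),
      IsTrajectory f a m θ Δ x z c ∧ x 0 = x₀ ∧ z 0 = z₀ ∧ c 0 = c₀ := by
  obtain ⟨γ, h0, hγ⟩ := exists_solution_Ici (locallyLipschitz_loopField (a := a) (θ := θ) hm hΔ hf)
    (x₀, z₀, c₀, fun _ => 0)
    (fun T _ => exists_loop_bound hN hm hΔ hf hmono ha hconn (x₀, z₀, c₀, fun _ => 0) hc₀)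
  have hz : ContinuousOn (fun t => (γ t).2.1) (Ici 0) := fun t ht =>
    (hγ t ht).continuousWithinAt.snd.fst
  -- the state variable `w`, started at `0`, is the gradient integral
  have hw : ∀ i, ∀ t : ℝ, 0 ≤ t → gradInt f (fun t => (γ t).2.1) i t = (γ t).2.2.2 i := by
    intro i t ht
    have hd : ∀ t, 0 ≤ t → HasDerivWithinAt (fun t => (γ t).2.2.2 i)
        (ownGrad f i ((γ t).2.1 i)) (Ici 0) t := fun t ht =>
      hasDerivWithinAt_pi.1 (hγ t ht).snd.snd.snd i
    have hcont : ContinuousOn (fun t => ownGrad f i ((γ t).2.1 i)) (Icc 0 t) :=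
      (locallyLipschitz_ownGrad hf i).continuous.comp_continuousOn
        ((continuous_apply i).comp_continuousOn (hz.mono Icc_subset_Ici_self))
    rw [gradInt, intervalIntegral.integral_eq_sub_of_hasDeriv_right_of_le ht
      (f := fun t => (γ t).2.2.2 i)
      (fun s hs => (hd s hs.1).continuousWithinAt.mono Icc_subset_Ici_self)
      (fun s hs => (hd s hs.1.le).mono (Ioi_subset_Ici hs.1.le))
      (hcont.intervalIntegrable_of_Icc ht), h0, sub_zero]
  refine ⟨fun t => (γ t).1, fun t => (γ t).2.1, fun t => (γ t).2.2.1, ⟨?_, ?_, ?_, ?_⟩, ?_⟩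
  · simpa only [h0] using hc₀
  · intro i t ht
    rw [hw i t ht]
    exact hasDerivWithinAt_pi.1 (hγ t ht).fst i
  · intro i j t ht
    simp only [hw _ t ht]
    exact hasDerivWithinAt_pi.1 (hasDerivWithinAt_pi.1 (hγ t ht).snd.fst i) j
  · intro i j t ht
    simp only [hw _ t ht]
    exact hasDerivWithinAt_pi.1 (hasDerivWithinAt_pi.1 (hγ t ht).snd.snd.fst i) j
  · simp [h0]

/-- The gradient integrals of a trajectory are differentiable on `[0, ∞)`. -/
theorem hasDerivWithinAt_gradInt (hf : SmoothLipschitz f) {z : ℝ → Fin N → Fin N → ℝ}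
    (hz : ContinuousOn z (Ici 0)) (i : Fin N) {t : ℝ} (ht : 0 ≤ t) :
    HasDerivWithinAt (fun t => gradInt f z i t) (ownGrad f i (z t i)) (Ici 0) t := by
  -- freezing `z` before time `0` makes the integrand continuous on the whole line
  have hc : Continuous fun τ => ownGrad f i (z (max τ 0) i) := by
    have h1 : Continuous fun τ => z (max τ 0) :=
      hz.comp_continuous (by fun_prop) fun τ => mem_Ici.2 (le_max_right _ _)
    exact (locallyLipschitz_ownGrad hf i).continuous.comp ((continuous_apply i).comp h1)
  have h := (hc.integral_hasStrictDerivAt 0 t).hasDerivAt.hasDerivWithinAt (s := Ici 0)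
  rw [max_eq_left ht] at h
  have heq : ∀ s ∈ Ici (0 : ℝ),
      gradInt f z i s = ∫ τ in (0 : ℝ)..s, ownGrad f i (z (max τ 0) i) := by
    intro s hs
    refine intervalIntegral.integral_congr fun τ hτ => ?_
    rw [uIcc_of_le hs] at hτ
    simp only [max_eq_left hτ.1]
  exact h.congr heq (heq t ht)

/-- The limits along any trajectory: the Lyapunov argument settles the estimation subsystem, which
then drives every integrator chain to its equilibrium. -/
theorem trajectory_converges (hN : 1 < N) {m : Fin N → ℕ} (hm : ∀ i, 0 < m i) {θ Δ : Fin N → ℝ}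
    (hθ : ∀ i, 0 < θ i ∧ θ i < 1 / 2) (hΔ : ∀ i, 0 < Δ i) (hf : SmoothLipschitz f)
    (hmono : StronglyMonotone f) (ha : IsAdjacency a) (hconn : StronglyConnected a)
    {ystar : Fin N → ℝ} (hy : ∀ i, ownGrad f i ystar = 0)
    {x : ℝ → (i : Fin N) → Fin (m i) → ℝ} {z c : ℝ → Fin N → Fin N → ℝ}
    (h : IsTrajectory f a m θ Δ x z c) :
    (∀ i, Tendsto (fun t => x t i) atTop (𝓝 (ystar i • sysC (m i)))) ∧
      (∀ i j, Tendsto (fun t => z t i j) atTop (𝓝 (ystar j))) ∧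
      ∀ i j, ∃ L, Tendsto (fun t => c t i j) atTop (𝓝 L) := by
  obtain ⟨r, K, b, C, hr, hK, hC0, hC, hD, hR⟩ := exists_lyapunov hN hf hmono ha hconn hy
  have hz : ContinuousOn z (Ici 0) := continuousOn_pi.2 fun i => continuousOn_pi.2 fun j t ht =>
    (h.z_deriv i j t ht).continuousWithinAt
  have hw := fun i (t : ℝ) (ht : 0 ≤ t) => hasDerivWithinAt_gradInt hf hz i ht
  set γ : ℝ → EstState N := fun t => (z t, c t, fun i => gradInt f z i t) with hγdef
  have hγ : ∀ t, 0 ≤ t → HasDerivWithinAt γ (estField f a (γ t)) (Ici 0) t := fun t ht =>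
    (hasDerivWithinAt_pi.2 fun i => hasDerivWithinAt_pi.2 fun j => h.z_deriv i j t ht).prodMk
      ((hasDerivWithinAt_pi.2 fun i => hasDerivWithinAt_pi.2 fun j => h.c_deriv i j t ht).prodMk
        (hasDerivWithinAt_pi.2 fun i => hw i t ht))
  have hγ1 : ∀ t ∈ Ici (0 : ℝ), HasDerivWithinAt γ ((1 : ℝ) • estField f a (γ t)) (Ici 0) t :=
    fun t ht => by rw [one_smul]; exact hγ t ht
  obtain ⟨hcm, hc0, hV⟩ := estField_invariant hD (convex_Ici 0) Subset.rfl self_mem_Ici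
    (k := fun _ => 1) (fun _ => zero_le_one) hγ1 h.gain_pos
  obtain ⟨R, hR⟩ := hR (lyap a r ystar K b (γ 0))
  have hbound : ∀ t, 0 ≤ t → ‖γ t‖ ≤ R := fun t ht => hR _ (hc0 t ht) (hV t ht)
  have hres : Tendsto (fun t => residual a ystar (γ t)) atTop (𝓝 0) := by
    refine tendsto_zero_of_lyapunov (continuous_estField hf) hγ hbound
      (by unfold residual consErr; fun_prop) (residual_nonneg a ystar)
      (v := fun t => lyap a r ystar K b (γ t)) (v' := fun t => 1 * lyapDeriv f a r ystar K b (γ t))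
      (fun t ht => hasDerivWithinAt_lyap f a r ystar K b (hγ1 t ht))
      (fun t _ => by rw [one_mul]; exact hD _)
      (b := 0) (fun t ht => lyap_nonneg hr hK (hc0 t ht))
  have hsq : ∀ g : ℝ → ℝ, (∀ t, g t ^ 2 ≤ (1 + C) * residual a ystar (γ t)) →
      Tendsto g atTop (𝓝 0) := by
    intro g hg
    have h1 : Tendsto (fun t => (1 + C) * residual a ystar (γ t)) atTop (𝓝 0) := by
      simpa using hres.const_mul (1 + C)
    have h2 : Tendsto (fun t => g t ^ 2) atTop (𝓝 0) :=
      squeeze_zero (fun t => sq_nonneg _) hg h1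
    have h3 := h2.sqrt
    simp only [Real.sqrt_sq_eq_abs, Real.sqrt_zero] at h3
    exact (tendsto_zero_iff_abs_tendsto_zero _).2 h3
  have hconsnn : ∀ t, 0 ≤ ∑ i, ∑ j, consErr a (γ t).1 (γ t).2.2 i j ^ 2 := fun t => by positivity
  have hdistnn : ∀ t, 0 ≤ ∑ j, ((γ t).2.2 j + ystar j) ^ 2 := fun t => by positivity
  have hwlim : ∀ j, Tendsto (fun t => gradInt f z j t) atTop (𝓝 (-ystar j)) := by
    intro j
    have h1 := hsq (fun t => gradInt f z j t + ystar j) fun t => by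
      have h2 : (gradInt f z j t + ystar j) ^ 2 ≤ ∑ j, ((γ t).2.2 j + ystar j) ^ 2 :=
        Finset.single_le_sum (f := fun j => ((γ t).2.2 j + ystar j) ^ 2)
          (fun j _ => sq_nonneg _) (Finset.mem_univ j)
      have h3 := hconsnn t
      have h4 := residual_nonneg a ystar (γ t)
      have h5 : residual a ystar (γ t) = ∑ j, ((γ t).2.2 j + ystar j) ^ 2
        + ∑ i, ∑ j, consErr a (γ t).1 (γ t).2.2 i j ^ 2 := rfl
      nlinarith
    simpa using h1.sub_const (ystar j)
  have hzlim : ∀ i j, Tendsto (fun t => z t i j) atTop (𝓝 (ystar j)) := by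
    intro i j
    have h1 := hsq (fun t => z t i j + gradInt f z j t) fun t => by
      have h2 : (z t i j + gradInt f z j t) ^ 2 ≤ ∑ i, ∑ j, (z t i j + gradInt f z j t) ^ 2 :=
        (Finset.single_le_sum (f := fun j => (z t i j + gradInt f z j t) ^ 2)
          (fun j _ => sq_nonneg _) (Finset.mem_univ j)).trans
        (Finset.single_le_sum (f := fun i => ∑ j, (z t i j + gradInt f z j t) ^ 2)
          (fun i _ => Finset.sum_nonneg fun j _ => sq_nonneg _) (Finset.mem_univ i))
      have h3 := hC fun i j => z t i j + gradInt f z j t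
      simp only [← consErr_eq_consOp a (z t) (fun j => gradInt f z j t)] at h3
      have h4 := residual_nonneg a ystar (γ t)
      have h5 : residual a ystar (γ t) = ∑ j, ((γ t).2.2 j + ystar j) ^ 2
        + ∑ i, ∑ j, consErr a (z t) (fun j => gradInt f z j t) i j ^ 2 := rfl
      have h6 := mul_nonneg hC0.le (hdistnn t)
      nlinarith
    simpa using h1.sub (hwlim j)
  have hglim : ∀ i, Tendsto (fun t => ownGrad f i (z t i)) atTop (𝓝 0) := by
    intro i
    have h1 : Tendsto (fun t => z t i) atTop (𝓝 ystar) := tendsto_pi_nhds.2 (hzlim i)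
    have h2 := ((locallyLipschitz_ownGrad hf i).continuous.tendsto ystar).comp h1
    rwa [hy i] at h2
  refine ⟨fun i => ?_, hzlim, fun i j => ?_⟩
  · exact player_tendsto (hm i) (hθ i).1 (hθ i).2 (hΔ i) (fun t ht => h.x_deriv i t ht)
      (fun t ht => hw i t ht) (hglim i) (hwlim i)
  · -- the gain is nondecreasing and bounded
    have h1 : Monotone fun t => c (max t 0) i j := fun s t hst =>
      hcm i j (mem_Ici.2 (le_max_right _ _)) (mem_Ici.2 (le_max_right _ _)) (max_le_max hst le_rfl)
    have h2 : BddAbove (range fun t => c (max t 0) i j) := by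
      refine ⟨R, ?_⟩
      rintro _ ⟨t, rfl⟩
      have h3 := hbound (max t 0) (le_max_right _ _)
      have h4 : ‖c (max t 0)‖ ≤ ‖γ (max t 0)‖ := 
        (norm_fst_le (γ (max t 0)).2).trans (norm_snd_le (γ (max t 0)))
      exact (le_abs_self _).trans ((norm_le_pi_norm (c (max t 0) i) j).trans
        ((norm_le_pi_norm (c (max t 0)) i).trans (h4.trans h3)))
    refine ⟨_, (tendsto_atTop_ciSup h1 h2).congr' ?_⟩
    filter_upwards [eventually_ge_atTop 0] with t ht
    rw [max_eq_left ht]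

end

end NashSeeking

theorem theorem1 (N : ℕ) (hN : 1 < N)
    (m : Fin N → ℕ) (hm : ∀ i, 1 < m i)
    (f : Fin N → (Fin N → ℝ) → ℝ)
    (hf : NashSeeking.SmoothLipschitz f) (hmono : NashSeeking.StronglyMonotone f)
    (a : Matrix (Fin N) (Fin N) ℝ)
    (ha : NashSeeking.IsAdjacency a) (hconn : NashSeeking.StronglyConnected a)
    (θ Δ : Fin N → ℝ) (hθ : ∀ i, 0 < θ i ∧ θ i < 1 / 2) (hΔ : ∀ i, 0 < Δ i) :
    (∃! ystar : Fin N → ℝ, NashSeeking.IsNash f ystar) ∧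
    (∀ (x₀ : (i : Fin N) → Fin (m i) → ℝ) (z₀ c₀ : Fin N → Fin N → ℝ),
      (∀ i j, 0 < c₀ i j) →
      ∃ (x : ℝ → (i : Fin N) → Fin (m i) → ℝ) (z c : ℝ → Fin N → Fin N → ℝ),
        NashSeeking.IsTrajectory f a m θ Δ x z c ∧ x 0 = x₀ ∧ z 0 = z₀ ∧ c 0 = c₀) ∧
    (∀ ystar : Fin N → ℝ, NashSeeking.IsNash f ystar →
      ∀ (x : ℝ → (i : Fin N) → Fin (m i) → ℝ) (z c : ℝ → Fin N → Fin N → ℝ),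
        NashSeeking.IsTrajectory f a m θ Δ x z c →
        Filter.Tendsto (fun t => NashSeeking.euclNorm (NashSeeking.output (x t) - ystar))
          Filter.atTop (nhds 0) ∧
        (∀ i k, NashSeeking.BoundedConvergent (fun t => x t i k)) ∧
        (∀ i j, NashSeeking.BoundedConvergent (fun t => z t i j)) ∧
        (∀ i j, NashSeeking.BoundedConvergent (fun t => c t i j))) := by
  have hm0 : ∀ i, 0 < m i := fun i => zero_lt_one.trans (hm i)
  refine ⟨NashSeeking.existsUnique_isNash hf hmono, fun x₀ z₀ c₀ hc₀ =>
    NashSeeking.exists_trajectory hN hm0 hΔ hf hmono ha hconn x₀ z₀ c₀ hc₀,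
    fun ystar hy x z c h => ?_⟩
  obtain ⟨hx, hz, hc⟩ := NashSeeking.trajectory_converges hN hm0 hθ hΔ hf hmono ha hconn
    ((NashSeeking.isNash_iff hf hmono ystar).1 hy) h
  refine ⟨?_, fun i k => ?_, fun i j => ?_, fun i j => ?_⟩
  · have h1 : Filter.Tendsto (fun t => NashSeeking.output (x t) - ystar) Filter.atTop (nhds 0) := by
      refine tendsto_pi_nhds.2 fun i => ?_
      have h2 := (tendsto_pi_nhds.1 (hx i) ⟨0, hm0 i⟩).sub_const (ystar i)
      simp only [NashSeeking.output, Pi.sub_apply, NashSeeking.sysC_dotProduct (hm0 i)]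
      simpa [NashSeeking.sysC] using h2
    have h3 : Continuous fun v : Fin N → ℝ => NashSeeking.euclNorm v :=
      continuous_norm.comp (EuclideanSpace.equiv (Fin N) ℝ).symm.continuous
    have h4 := (h3.tendsto 0).comp h1
    have h5 : NashSeeking.euclNorm (0 : Fin N → ℝ) = 0 := by simp [NashSeeking.euclNorm]
    rw [h5] at h4
    exact h4
  · exact NashSeeking.boundedConvergent_of_tendsto
      (fun t ht => (hasDerivWithinAt_pi.1 (h.x_deriv i t ht) k).continuousWithinAt)
      (tendsto_pi_nhds.1 (hx i) k)
  · exact NashSeeking.boundedConvergent_of_tendsto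
      (fun t ht => (h.z_deriv i j t ht).continuousWithinAt) (hz i j)
  · obtain ⟨L, hL⟩ := hc i j
    exact NashSeeking.boundedConvergent_of_tendsto
      (fun t ht => (h.c_deriv i j t ht).continuousWithinAt) hL
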